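/- All Hilbert spaces are finite-dimensional, $\mathcal{D}(\mathcal{H})$ is the set of density operators on $\mathcal{H}$, $H(\rho)=-\mathrm{Tr}(\rho\log\rho)$ is the von Neumann entropy, and $D(\rho\Vert\sigma)=\mathrm{Tr}(\rho\log\rho-\rho\log\sigma)$ if $\mathrm{supp}\,\rho\subseteq\mathrm{supp}\,\sigma$ and $D(\rho\Vert\sigma)=+\infty$ otherwise. All logarithms are to the same base. Let $\mathcal{N}:\mathcal{D}(\mathcal{H}_A)\to\mathcal{D}(\mathcal{H}_B)$ be a quantum channel (a linear, completely positive, trace-preserving map) and $\mathcal{N}^n=\mathcal{N}^{\otimes n}$. For a channel $\Phi$ let $$\chi(\Phi)=\sup_{\{p_x,\rho_x\}}\Big[H\Big(\sum_x p_x\Phi(\rho_x)\Big)-\sum_x p_xH(\Phi(\rho_x))\Big],$$ the supremum being over all finite ensembles of input states of $\Phi$. An $(n,M,\epsilon)$ code for $\mathcal{N}$ consists of an encoder, which sends each message $m\in\{1,\dots,M\}$ with conditional probability $p(a|m)$ to a (possibly entangled) state $\rho_a\in\mathcal{D}(\mathcal{H}_A^{\otimes n})$, where $a$ ranges over a finite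 set of labels, and of a decoding POVM $\{E_m\}_{m=1}^M$ on $\mathcal{H}_B^{\otimes n}$, such that, with $f(m)=\sum_a p(a|m)\rho_a$, one has $\mathrm{Tr}(\mathcal{N}^n(f(m))E_m)\ge 1-\epsilon$ for all $m$ (maximal error criterion), or $\frac1M\sum_{m=1}^M\mathrm{Tr}(\mathcal{N}^n(f(m))E_m)\ge 1-\epsilon$ (average error criterion). Fix either one of the two criteria. Let $\mathcal{C}_\epsilon(\mathcal{N})$ be the supremum of all real $R$ such that for every $\delta>0$ there is an $n_0$ such that for all $n\ge n_0$ there is an $(n,M,\epsilon)$ code for $\mathcal{N}$ with $\frac1n\log M\ge R-\delta$, and let $\mathcal{C}(\mathcal{N})=\lim_{\epsilon\to0^+}\mathcal{C}_\epsilon(\mathcal{N})$ be the classical capacity of $\mathcal{N}$. **Theorem.** Consider a good code sequence for $\mathcal{N}$, that is, for each $n$ an $(n,M_n,\epsilon_n)$ code for $\mathcal{N}$, such that $\frac1n\log M_n\to\mathcal{C}(\mathcal{N})$ and $\epsilon_n\to0$ as $n\to\infty$. For each $n$ let $\{\bar p_{x},\bar\rho_{x}\}$ be any finite ensemble of states in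 $\mathcal{D}(\mathcal{H}_A^{\otimes n})$ (depending on $n$) that attains $\chi(\mathcal{N}^n)$, that is, $$\chi(\mathcal{N}^n)=H\Big(\sum_{x}\bar p_{x}\mathcal{N}^n(\bar\rho_{x})\Big)-\sum_{x}\bar p_{x}H(\mathcal{N}^n(\bar\rho_{x})).$$ Then $$\lim_{n\to\infty}\frac1n D(\omega_n\Vert\bar\omega_n)=0,$$ where $\bar\omega_n=\sum_{x}\bar p_{x}\mathcal{N}^n(\bar\rho_{x})$, and $\omega_n=\frac1{M_n}\sum_{m=1}^{M_n}\sum_a p(a|m)\mathcal{N}^n(\rho_a)$ is the output state induced by the $n$-th code. -/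

import Mathlib

open Filter Topology
open scoped ComplexOrder

noncomputable section

namespace QuantumCode

/-- Density matrices on the Hilbert space `ℂ^d`. -/
def IsDensity {d : Type*} [Fintype d] (ρ : Matrix d d ℂ) : Prop :=
  ρ.PosSemidef ∧ ρ.trace = 1

/-- The map `N ⊗ id_k` on operators on `ℂ^A ⊗ ℂ^k`, applied blockwise. -/
def ampliation {A B : Type*} (N : Matrix A A ℂ →ₗ[ℂ] Matrix B B ℂ) (k : ℕ)
    (V : Matrix (A × Fin k) (A × Fin k) ℂ) : Matrix (B × Fin k) (B × Fin k) ℂ :=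
  Matrix.of fun x y => N (Matrix.of fun a a' => V (a, x.2) (a', y.2)) x.1 y.1

/-- Quantum channels: completely positive, trace-preserving linear maps. -/
structure IsQuantumChannel {A B : Type*} [Fintype A] [Fintype B]
    (N : Matrix A A ℂ →ₗ[ℂ] Matrix B B ℂ) : Prop where
  completelyPositive : ∀ (k : ℕ) (V : Matrix (A × Fin k) (A × Fin k) ℂ),
    V.PosSemidef → (ampliation N k V).PosSemidef
  tracePreserving : ∀ X : Matrix A A ℂ, (N X).trace = X.trace

/-- The `n`-fold tensor power `N ⊗ ⋯ ⊗ N`. The space `(ℂ^A)^{⊗ n}` has the product basis indexed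
by `Fin n → A`; the matrix unit `|a⟩⟨a'|` is the tensor product of the `|aᵢ⟩⟨a'ᵢ|`, and it is sent
to the tensor product of the `N |aᵢ⟩⟨a'ᵢ|`. -/
def tensorPower {A B : Type*} [Fintype A] [DecidableEq A]
    (N : Matrix A A ℂ →ₗ[ℂ] Matrix B B ℂ) (n : ℕ) :
    Matrix (Fin n → A) (Fin n → A) ℂ →ₗ[ℂ] Matrix (Fin n → B) (Fin n → B) ℂ where
  toFun X := Matrix.of fun b b' =>
    ∑ a : Fin n → A, ∑ a' : Fin n → A,
      X a a' * ∏ i, N (Matrix.single (a i) (a' i) 1) (b i) (b' i)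
  map_add' X Y := by
    ext b b'
    simp [add_mul, Finset.sum_add_distrib]
  map_smul' c X := by
    ext b b'
    simp [Finset.mul_sum, mul_assoc]

/-- The tensor power acts factorwise on product operators. -/
theorem tensorPower_prod {A B : Type*} [Fintype A] [DecidableEq A]
    (N : Matrix A A ℂ →ₗ[ℂ] Matrix B B ℂ) (n : ℕ) (X : Fin n → Matrix A A ℂ) :
    tensorPower N n (Matrix.of fun a a' => ∏ i, X i (a i) (a' i)) =
      Matrix.of fun b b' => ∏ i, N (X i) (b i) (b' i) := by
  ext b b'
  have key : ∀ Y : Matrix A A ℂ, ∀ u v : B,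
      N Y u v = ∑ q : A × A, Y q.1 q.2 * N (Matrix.single q.1 q.2 1) u v := by
    intro Y u v
    conv_lhs => rw [Matrix.matrix_eq_sum_single Y]
    rw [Fintype.sum_prod_type]
    simp only [map_sum, Matrix.sum_apply]
    refine Finset.sum_congr rfl fun a _ => Finset.sum_congr rfl fun a' _ => ?_
    have h : Matrix.single a a' (Y a a') = Y a a' • Matrix.single a a' (1 : ℂ) := by
      simp [Matrix.smul_single]
    rw [h, map_smul]
    simp
  simp only [tensorPower, LinearMap.coe_mk, AddHom.coe_mk, Matrix.of_apply]
  simp_rw [key (X _), Fintype.prod_sum, ← Finset.prod_mul_distrib]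
  rw [← Fintype.sum_prod_type' (f := fun (a a' : Fin n → A) =>
    ∏ i, (X i (a i) (a' i) * N (Matrix.single (a i) (a' i) 1) (b i) (b' i)))]
  exact (Fintype.sum_equiv (Equiv.arrowProdEquivProdArrow (Fin n) (fun _ => A) (fun _ => A))
    _ _ (fun _ => rfl)).symm

/-- Von Neumann entropy `H(ρ) = - Tr (ρ log ρ)` (natural logarithm, `0 log 0 = 0`). -/
def entropy {d : Type*} [Fintype d] [DecidableEq d] (ρ : Matrix d d ℂ) : ℝ :=
  -(ρ * cfc Real.log ρ).trace.re

open Classical in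
/-- Quantum relative entropy. Supports are orthogonal complements of kernels, so that
`supp ρ ⊆ supp σ` says `ker σ ⊆ ker ρ`. In the first case the value that the functional calculus
gives to `log σ` on `ker σ` (namely `log 0 = 0`) does not affect the trace. -/
def relEntropy {d : Type*} [Fintype d] [DecidableEq d] (ρ σ : Matrix d d ℂ) : EReal :=
  if ∀ v : d → ℂ, σ.mulVec v = 0 → ρ.mulVec v = 0 then
    (((ρ * cfc Real.log ρ - ρ * cfc Real.log σ).trace.re : ℝ) : EReal)
  else ⊤

/-- Finite ensembles `{p_x, ρ_x}` of states. -/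
structure Ensemble (d : Type*) [Fintype d] where
  card : ℕ
  p : Fin card → ℝ
  ρ : Fin card → Matrix d d ℂ
  p_nonneg : ∀ x, 0 ≤ p x
  p_sum : ∑ x, p x = 1
  isDensity : ∀ x, IsDensity (ρ x)

/-- The mean output state `∑ₓ pₓ Φ(ρₓ)` of an ensemble. -/
def Ensemble.output {A B : Type*} [Fintype A] (Φ : Matrix A A ℂ →ₗ[ℂ] Matrix B B ℂ)
    (e : Ensemble A) : Matrix B B ℂ :=
  ∑ x, (e.p x : ℂ) • Φ (e.ρ x)

/-- `H(∑ₓ pₓ Φ(ρₓ)) - ∑ₓ pₓ H(Φ(ρₓ))`. -/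
def Ensemble.holevoInfo {A B : Type*} [Fintype A] [Fintype B] [DecidableEq B]
    (Φ : Matrix A A ℂ →ₗ[ℂ] Matrix B B ℂ) (e : Ensemble A) : ℝ :=
  entropy (e.output Φ) - ∑ x, e.p x * entropy (Φ (e.ρ x))

/-- The Holevo quantity `χ(Φ)`: the supremum over all ensembles of input states. -/
def holevoChi {A B : Type*} [Fintype A] [Fintype B] [DecidableEq B]
    (Φ : Matrix A A ℂ →ₗ[ℂ] Matrix B B ℂ) : EReal :=
  ⨆ e : Ensemble A, ((e.holevoInfo Φ : ℝ) : EReal)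

/-- Classical codes with `M` messages for one use of a quantum channel with input space `ℂ^A` and
output space `ℂ^B`: a (possibly randomized) encoder, which sends the message `m` to the state `ρ a`
with probability `p m a`, and a decoding POVM `E`. -/
structure Code (A B : Type*) [Fintype A] [Fintype B] [DecidableEq B] (M : ℕ) where
  labels : ℕ
  p : Fin M → Fin labels → ℝ
  ρ : Fin labels → Matrix A A ℂ
  E : Fin M → Matrix B B ℂ
  p_nonneg : ∀ m a, 0 ≤ p m a
  p_sum : ∀ m, ∑ a, p m a = 1
  isDensity : ∀ a, IsDensity (ρ a)
  E_posSemidef : ∀ m, (E m).PosSemidef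
  E_sum : ∑ m, E m = 1

/-- The codeword `f(m) = ∑ₐ p(a|m) ρₐ`. -/
def Code.codeword {A B : Type*} [Fintype A] [Fintype B] [DecidableEq B] {M : ℕ}
    (c : Code A B M) (m : Fin M) : Matrix A A ℂ :=
  ∑ a, (c.p m a : ℂ) • c.ρ a

/-- The probability `Tr (Φ(f(m)) E_m)` that message `m` is decoded correctly. -/
def Code.successProb {A B : Type*} [Fintype A] [Fintype B] [DecidableEq B] {M : ℕ}
    (c : Code A B M) (Φ : Matrix A A ℂ →ₗ[ℂ] Matrix B B ℂ) (m : Fin M) : ℝ :=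
  (Φ (c.codeword m) * c.E m).trace.re

/-- The output state `(1/M) ∑ₘ ∑ₐ p(a|m) Φ(ρₐ)` induced by a code. -/
def Code.output {A B : Type*} [Fintype A] [Fintype B] [DecidableEq B] {M : ℕ}
    (c : Code A B M) (Φ : Matrix A A ℂ →ₗ[ℂ] Matrix B B ℂ) : Matrix B B ℂ :=
  (1 / (M : ℂ)) • ∑ m, ∑ a, (c.p m a : ℂ) • Φ (c.ρ a)

/-- The two error criteria for codes. -/
inductive ErrorCriterion where
  | maximal
  | average

/-- The code has (maximal, resp. average) error probability `ε` for the channel `Φ`. -/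
def Code.HasError {A B : Type*} [Fintype A] [Fintype B] [DecidableEq B] {M : ℕ}
    (c : Code A B M) (Φ : Matrix A A ℂ →ₗ[ℂ] Matrix B B ℂ) (ε : ℝ) : ErrorCriterion → Prop
  | .maximal => ∀ m, 1 - ε ≤ c.successProb Φ m
  | .average => 1 - ε ≤ (1 / (M : ℝ)) * ∑ m, c.successProb Φ m

/-- `(n, M, ε)` codes for `N`: the channel is used `n` times, with arbitrary (entangled) codewords
in `(ℂ^A)^{⊗ n}`. The set of `R` such that, for all `δ > 0` and all large `n`, there is an
`(n, M, ε)` code for `N` with `(1/n) log M ≥ R - δ`. -/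
def achievableRates {A B : Type*} [Fintype A] [DecidableEq A] [Fintype B] [DecidableEq B]
    (N : Matrix A A ℂ →ₗ[ℂ] Matrix B B ℂ) (crit : ErrorCriterion) (ε : ℝ) : Set ℝ :=
  {R | ∀ δ > 0, ∃ n₀ : ℕ, ∀ n ≥ n₀, ∃ (M : ℕ) (c : Code (Fin n → A) (Fin n → B) M),
    c.HasError (tensorPower N n) ε crit ∧ R - δ ≤ (1 / (n : ℝ)) * Real.log M}

/-- The `ε`-capacity `C_ε(N)`, in the extended reals. -/
def epsCapacity {A B : Type*} [Fintype A] [DecidableEq A] [Fintype B] [DecidableEq B]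
    (N : Matrix A A ℂ →ₗ[ℂ] Matrix B B ℂ) (crit : ErrorCriterion) (ε : ℝ) : EReal :=
  sSup ((fun R : ℝ => (R : EReal)) '' achievableRates N crit ε)

/-- The classical capacity `C(N) = lim_{ε → 0⁺} C_ε(N)`. -/
def capacity {A B : Type*} [Fintype A] [DecidableEq A] [Fintype B] [DecidableEq B]
    (N : Matrix A A ℂ →ₗ[ℂ] Matrix B B ℂ) (crit : ErrorCriterion) : EReal :=
  limUnder (𝓝[>] (0 : ℝ)) (epsCapacity N crit)

theorem epsCapacity_mono {A B : Type*} [Fintype A] [DecidableEq A] [Fintype B] [DecidableEq B]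
    (N : Matrix A A ℂ →ₗ[ℂ] Matrix B B ℂ) (crit : ErrorCriterion) :
    Monotone (epsCapacity N crit) := by
  intro ε ε' h
  refine sSup_le_sSup (Set.image_mono ?_)
  intro R hR δ hδ
  obtain ⟨n₀, hn₀⟩ := hR δ hδ
  refine ⟨n₀, fun n hn => ?_⟩
  obtain ⟨M, c, hc, hM⟩ := hn₀ n hn
  refine ⟨M, c, ?_, hM⟩
  cases crit with
  | maximal => exact fun m => le_trans (by linarith) (hc m)
  | average => exact le_trans (by linarith) hc

/-- The limit that defines the capacity exists. -/
theorem tendsto_capacity {A B : Type*} [Fintype A] [DecidableEq A] [Fintype B] [DecidableEq B]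
    (N : Matrix A A ℂ →ₗ[ℂ] Matrix B B ℂ) (crit : ErrorCriterion) :
    Tendsto (epsCapacity N crit) (𝓝[>] (0 : ℝ)) (𝓝 (capacity N crit)) :=
  tendsto_nhds_limUnder ⟨_, (epsCapacity_mono N crit).tendsto_nhdsGT 0⟩

/-- Good code sequences: the code number `n` is an `(n, Mₙ, εₙ)` code for `N`, with
`(1/n) log Mₙ → C(N)` and `εₙ → 0`. -/
structure IsGoodCodeSequence {A B : Type*} [Fintype A] [DecidableEq A] [Fintype B] [DecidableEq B]
    (N : Matrix A A ℂ →ₗ[ℂ] Matrix B B ℂ) (crit : ErrorCriterion) (M : ℕ → ℕ) (ε : ℕ → ℝ)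
    (c : (n : ℕ) → Code (Fin n → A) (Fin n → B) (M n)) : Prop where
  hasError : ∀ n, (c n).HasError (tensorPower N n) (ε n) crit
  rate : Tendsto (fun n : ℕ => (((1 / (n : ℝ)) * Real.log (M n) : ℝ) : EReal)) atTop
    (𝓝 (capacity N crit))
  error : Tendsto ε atTop (𝓝 0)

end QuantumCode

end

/-! Write χ_n for χ(N^n). The proof bounds D(ω_n‖ω̄_n) by χ_n minus a quantity close to log M_n, and
then divides by n.

Optimality enters through a perturbation. Mixing the optimal ensemble (weight 1 - t) with the
uniform ensemble of codewords (weight t) cannot push the Holevo information above χ_n. To first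
order as t → 0 this forces the support inclusion and D(ω_n‖ω̄_n) ≤ χ_n - χ(code), where χ(code) is
the Holevo information of the codeword ensemble (`relEntropy_of_entropy_mix_le`,
`relEntropy_output_le`). A decodable code has χ(code) ≥ (1 - 2ε_n) log M_n - 7 (`converse_bound`),
because each decoding operator tests its own output state against the average one.

The direct coding theorem for blocks gives χ_n / n ≤ C (`holevoInfo_div_le_capacity`). It rests on a
Feinstein-style greedy construction (`greedy_code`), fed by Chernoff bounds on the eigenvalues of
product states. Hence 0 ≤ D/n ≤ C - (1 - 2ε_n)(log M_n)/n + 7/n, which tends to 0. No single-letter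
formula for C and no additivity is needed. -/

namespace QuantumCode

open Matrix
open scoped MatrixOrder Kronecker

/-! ### Spectral calculus, Klein's inequality and elementary entropy bounds -/

section Spectral

variable {d : Type*} [Fintype d] [DecidableEq d]

theorem IsDensity.nonempty {d : Type*} [Fintype d] {X : Matrix d d ℂ} (hX : IsDensity X) :
    Nonempty d := by
  by_contra h
  rw [not_nonempty_iff] at h
  simpa [trace] using hX.2

theorem cfc_eq_conj {A : Matrix d d ℂ} (hA : A.IsHermitian) (f : ℝ → ℝ) :
    cfc f A = (hA.eigenvectorUnitary : Matrix d d ℂ) *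
      diagonal (fun i => (f (hA.eigenvalues i) : ℂ)) *
        star (hA.eigenvectorUnitary : Matrix d d ℂ) := by
  rw [hA.cfc_eq, IsHermitian.cfc, Unitary.conjStarAlgAut_apply]
  rfl

theorem trace_mul_cfc {A : Matrix d d ℂ} (hA : A.IsHermitian) (X : Matrix d d ℂ) (f : ℝ → ℝ) :
    (X * cfc f A).trace.re = ∑ j, ((star (hA.eigenvectorUnitary : Matrix d d ℂ) * X *
      (hA.eigenvectorUnitary : Matrix d d ℂ)) j j).re * f (hA.eigenvalues j) := by
  rw [cfc_eq_conj hA, ← mul_assoc, trace_mul_comm, ← mul_assoc, ← mul_assoc, trace, Complex.re_sum]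
  refine Finset.sum_congr rfl fun j _ => ?_
  rw [diag_apply, mul_diagonal, Complex.re_mul_ofReal]

/-- The weights are the squared overlaps |⟨uᵢ, vⱼ⟩|² of the two eigenbases. They do not depend on f
and g, so trace inequalities reduce to scalar inequalities between pairs of eigenvalues. -/
theorem exists_weights {A B : Matrix d d ℂ} (hA : A.IsHermitian) (hB : B.IsHermitian) :
    ∃ w : d → d → ℝ, (∀ i j, 0 ≤ w i j) ∧ ∀ f g : ℝ → ℝ,
      (cfc f A * cfc g B).trace.re =
        ∑ i, ∑ j, w i j * (f (hA.eigenvalues i) * g (hB.eigenvalues j)) := by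
  set U := (hA.eigenvectorUnitary : Matrix d d ℂ)
  set V := (hB.eigenvectorUnitary : Matrix d d ℂ)
  refine ⟨fun i j => Complex.normSq ((star U * V) i j), fun i j => Complex.normSq_nonneg _, ?_⟩
  intro f g
  rw [trace_mul_cfc hB, Finset.sum_comm]
  refine Finset.sum_congr rfl fun j _ => ?_
  have h : star V * cfc f A * V =
      star (star U * V) * diagonal (fun i => (f (hA.eigenvalues i) : ℂ)) * (star U * V) := by
    rw [cfc_eq_conj hA]
    simp only [star_mul, star_star, mul_assoc]
    rfl
  change ((star V * cfc f A * V) j j).re * _ = _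
  rw [h, mul_apply, Complex.re_sum, Finset.sum_mul]
  refine Finset.sum_congr rfl fun i _ => ?_
  rw [mul_diagonal, star_apply]
  simp only [RCLike.star_def, Complex.normSq_apply, Complex.mul_re, Complex.mul_im,
    Complex.conj_re, Complex.conj_im, Complex.ofReal_re, Complex.ofReal_im]
  ring

theorem cfc_real_const_one {A : Matrix d d ℂ} (hA : A.IsHermitian) :
    cfc (fun _ : ℝ => (1 : ℝ)) A = 1 := by
  rw [cfc_const_one ℝ A hA.isSelfAdjoint]

theorem cfc_real_id {A : Matrix d d ℂ} (hA : A.IsHermitian) :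
    cfc (fun x : ℝ => x) A = A := cfc_id' ℝ A hA

/-- The spectrum is finite, so every function is continuous on it; this lets `Real.log` be used
without excluding the eigenvalue 0. -/
theorem cfc_mul_any (A : Matrix d d ℂ) (f g : ℝ → ℝ) :
    cfc f A * cfc g A = cfc (fun x => f x * g x) A := by
  have hf : ∀ h : ℝ → ℝ, ContinuousOn h (spectrum ℝ A) := fun h =>
    (Set.toFinite _).continuousOn h
  rw [cfc_mul f g A (hf f) (hf g)]

theorem mul_cfc_self {A : Matrix d d ℂ} (hA : A.IsHermitian) (f : ℝ → ℝ) :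
    A * cfc f A = cfc (fun x => x * f x) A := by
  conv_lhs => enter [1]; rw [← cfc_real_id hA]
  exact cfc_mul_any A _ _

theorem trace_cfc_mono {A : Matrix d d ℂ} (hA : A.IsHermitian) {f g : ℝ → ℝ}
    (h : ∀ i, f (hA.eigenvalues i) ≤ g (hA.eigenvalues i)) :
    (cfc f A).trace.re ≤ (cfc g A).trace.re := by
  obtain ⟨w, hw, hfg⟩ := exists_weights hA hA
  have e : ∀ f : ℝ → ℝ, (cfc f A).trace.re = _ := fun f => by
    rw [← mul_one (cfc f A), ← cfc_real_const_one hA, hfg]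
  rw [e f, e g]
  gcongr with i _ j _
  exacts [hw i j, h i]

theorem PosSemidef.cfc_of_nonneg {A : Matrix d d ℂ} (hA : A.IsHermitian) {f : ℝ → ℝ}
    (h : ∀ i, 0 ≤ f (hA.eigenvalues i)) : (cfc f A).PosSemidef := by
  rw [cfc_eq_conj hA]
  refine PosSemidef.mul_mul_conjTranspose_same (PosSemidef.diagonal fun i => ?_) _
  simpa using h i

theorem trace_mul_nonneg {A B : Matrix d d ℂ} (hA : A.PosSemidef) (hB : B.PosSemidef) :
    0 ≤ (A * B).trace.re := by
  obtain ⟨w, hw, hfg⟩ := exists_weights hA.1 hB.1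
  have := hfg (fun x => x) (fun x => x)
  rw [cfc_real_id hA.1, cfc_real_id hB.1] at this
  rw [this]
  exact Finset.sum_nonneg fun i _ => Finset.sum_nonneg fun j _ =>
    mul_nonneg (hw i j) (mul_nonneg (hA.eigenvalues_nonneg i) (hB.eigenvalues_nonneg j))

theorem trace_mul_le_trace_mul {A B C : Matrix d d ℂ} (hA : A.PosSemidef) (h : B ≤ C) :
    (A * B).trace.re ≤ (A * C).trace.re := by
  have := trace_mul_nonneg hA (Matrix.le_iff.1 h)
  rw [mul_sub, trace_sub, Complex.sub_re] at this
  linarith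

/-- Young's inequality for the conjugate pair x log x - x and exp l. With l a free variable, no
support condition is needed at x = 0. -/
theorem sub_le_mul_log_sub_mul {x : ℝ} (hx : 0 ≤ x) (l : ℝ) :
    x - Real.exp l ≤ x * Real.log x - x * l := by
  rcases hx.eq_or_lt with rfl | hx
  · simpa using (Real.exp_pos l).le
  · have h := Real.log_le_sub_one_of_pos (div_pos (Real.exp_pos l) hx)
    rw [Real.log_div (Real.exp_pos l).ne' hx.ne', Real.log_exp] at h
    have h2 := mul_le_mul_of_nonneg_left h hx.le
    have h3 : x * (Real.exp l / x - 1) = Real.exp l - x := by field_simp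
    linarith [h3 ▸ h2]

/-- Klein's inequality, in variational form. -/
theorem klein {A B : Matrix d d ℂ} (hA : A.PosSemidef) (hB : B.IsHermitian) (g : ℝ → ℝ) :
    A.trace.re - (cfc (fun x => Real.exp (g x)) B).trace.re ≤
      (A * cfc Real.log A).trace.re - (A * cfc g B).trace.re := by
  obtain ⟨w, hw, hfg⟩ := exists_weights hA.1 hB
  have e1 : A.trace.re = (cfc (fun x : ℝ => x) A * cfc (fun _ : ℝ => (1 : ℝ)) B).trace.re := by
    rw [cfc_real_id hA.1, cfc_real_const_one hB, mul_one]
  have e2 : (cfc (fun x => Real.exp (g x)) B).trace.re =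
      (cfc (fun _ : ℝ => (1 : ℝ)) A * cfc (fun x => Real.exp (g x)) B).trace.re := by
    rw [cfc_real_const_one hA.1, one_mul]
  have e3 : (A * cfc Real.log A).trace.re =
      (cfc (fun x => x * Real.log x) A * cfc (fun _ : ℝ => (1 : ℝ)) B).trace.re := by
    rw [mul_cfc_self hA.1, cfc_real_const_one hB, mul_one]
  have e4 : (A * cfc g B).trace.re = (cfc (fun x : ℝ => x) A * cfc g B).trace.re := by
    rw [cfc_real_id hA.1]
  rw [e1, e2, e3, e4, hfg, hfg, hfg, hfg]
  simp only [← Finset.sum_sub_distrib, ← mul_sub]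
  refine Finset.sum_le_sum fun i _ => Finset.sum_le_sum fun j _ =>
    mul_le_mul_of_nonneg_left ?_ (hw i j)
  have := sub_le_mul_log_sub_mul (hA.eigenvalues_nonneg i) (g (hB.eigenvalues j))
  linarith

theorem cfc_add_const_any {A : Matrix d d ℂ} (hA : A.IsHermitian) (f : ℝ → ℝ) (s : ℝ) :
    cfc f (A + (s : ℂ) • (1 : Matrix d d ℂ)) = cfc (fun x => f (x + s)) A := by
  have hf : ∀ (h : ℝ → ℝ) (S : Set ℝ), S.Finite → ContinuousOn h S :=
    fun h S hS => hS.continuousOn h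
  have h1 : A + (s : ℂ) • (1 : Matrix d d ℂ) = cfc (fun x : ℝ => x + s) A := by
    rw [cfc_add_const s (fun x : ℝ => x) A (hf _ _ (Set.toFinite _))
      hA.isSelfAdjoint, cfc_real_id hA]
    congr 1
    ext i j
    simp [Matrix.algebraMap_matrix_apply, Matrix.one_apply]
  rw [h1, ← cfc_comp' f (fun x => x + s) A (hf _ _ ((Set.toFinite _).image _))
    (hf _ _ (Set.toFinite _)) hA.isSelfAdjoint]

theorem posDef_add_smul_one {d : Type*} [DecidableEq d] {A : Matrix d d ℂ} (hA : A.PosSemidef) {s : ℝ} (hs : 0 < s) :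
    (A + (s : ℂ) • (1 : Matrix d d ℂ)).PosDef :=
  PosDef.posSemidef_add hA (PosDef.one.smul (by exact_mod_cast hs))

theorem trace_add_smul_one (A : Matrix d d ℂ) (s : ℝ) :
    (A + (s : ℂ) • (1 : Matrix d d ℂ)).trace.re = A.trace.re + s * Fintype.card d := by
  simp [trace_add, trace_smul]

-- Operator monotonicity of the logarithm, the one non-commutative input to both the entropy
-- expansion and the pinching argument.
open scoped Matrix.Norms.L2Operator in
theorem cfc_log_le_cfc_log {A B : Matrix d d ℂ} (hA : A.PosDef) (h : A ≤ B) :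
    cfc Real.log A ≤ cfc Real.log B :=
  CFC.log_le_log h hA.isStrictlyPositive

theorem cfc_exp_log {A : Matrix d d ℂ} (hA : A.PosDef) :
    cfc (fun x => Real.exp (Real.log x)) A = A := by
  conv_rhs => rw [← cfc_real_id hA.1]
  rw [cfc_eq_conj hA.1, cfc_eq_conj hA.1]
  simp only [Real.exp_log (hA.eigenvalues_pos _)]

/-- Klein's inequality against `B + s`. -/
theorem klein_add {A B : Matrix d d ℂ} (hA : IsDensity A) (hB : IsDensity B) {s : ℝ}
    (hs : 0 < s) : -(s * Fintype.card d) ≤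
      (A * cfc Real.log A).trace.re - (A * cfc Real.log (B + (s : ℂ) • 1)).trace.re := by
  have hp := posDef_add_smul_one hB.1 hs
  have := klein hA.1 hp.1 Real.log
  rw [cfc_exp_log hp, trace_add_smul_one, hA.2, hB.2] at this
  simp only [Complex.one_re] at this
  linarith

theorem trace_mul_log_le {A : Matrix d d ℂ} (hA : A.PosSemidef) {s : ℝ} (hs : 0 < s) :
    (A * cfc Real.log A).trace.re ≤ (A * cfc Real.log (A + (s : ℂ) • 1)).trace.re := by
  rw [cfc_add_const_any hA.1, mul_cfc_self hA.1, mul_cfc_self hA.1]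
  refine trace_cfc_mono hA.1 fun i => ?_
  rcases (hA.eigenvalues_nonneg i).eq_or_lt with h | h
  · simp [← h]
  · exact mul_le_mul_of_nonneg_left (Real.log_le_log h (by linarith)) h.le

theorem entropy_le_log_card {A : Matrix d d ℂ} (hA : IsDensity A) :
    entropy A ≤ Real.log (Fintype.card d) := by
  have hd : (0 : ℝ) < Fintype.card d := by
    have := hA.nonempty
    exact_mod_cast Fintype.card_pos
  have := klein hA.1 hA.1.1 (fun _ => -Real.log (Fintype.card d))
  have e : ∀ c : ℝ, cfc (fun _ : ℝ => c) A = (c : ℂ) • (1 : Matrix d d ℂ) := by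
    intro c
    rw [cfc_const c A hA.1.1.isSelfAdjoint]
    ext i j
    simp [Matrix.algebraMap_matrix_apply, Matrix.one_apply]
  rw [e, e, Real.exp_neg, Real.exp_log hd] at this
  simp only [mul_smul_comm, mul_one, trace_smul, hA.2, trace_one, smul_eq_mul] at this
  rw [← Complex.ofReal_natCast, ← Complex.ofReal_mul, Complex.ofReal_re,
    inv_mul_cancel₀ hd.ne', Complex.ofReal_re, Complex.one_re] at this
  unfold entropy
  linarith

theorem IsDensity.sum_eigenvalues {A : Matrix d d ℂ} (hA : IsDensity A) :
    ∑ i, hA.1.1.eigenvalues i = 1 := by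
  have h : (1 : ℂ) = _ := hA.2.symm.trans hA.1.1.trace_eq_sum_eigenvalues
  apply Complex.ofReal_injective
  simpa using h.symm

theorem entropy_nonneg {A : Matrix d d ℂ} (hA : IsDensity A) : 0 ≤ entropy A := by
  have hsum := hA.sum_eigenvalues
  unfold entropy
  rw [mul_cfc_self hA.1.1, Left.nonneg_neg_iff]
  refine (trace_cfc_mono hA.1.1 (g := fun _ => 0) fun i => ?_).trans ?_
  · refine Real.mul_log_nonpos (hA.1.eigenvalues_nonneg i) ?_
    rw [← hsum]
    exact Finset.single_le_sum (fun j _ => hA.1.eigenvalues_nonneg j) (Finset.mem_univ i)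
  · simp [cfc_const_zero]

theorem IsDensity.le_one {A : Matrix d d ℂ} (hA : IsDensity A) : A ≤ 1 := by
  have hsum := hA.sum_eigenvalues
  rw [Matrix.le_iff]
  have : (1 : Matrix d d ℂ) - A = cfc (fun x : ℝ => 1 - x) A := by
    have hf : ∀ h : ℝ → ℝ, ContinuousOn h (spectrum ℝ A) := fun h =>
      (Set.toFinite _).continuousOn h
    rw [cfc_sub (fun _ : ℝ => (1 : ℝ)) (fun x => x) A (hf _) (hf _), cfc_real_const_one hA.1.1,
      cfc_real_id hA.1.1]
  rw [this]
  refine PosSemidef.cfc_of_nonneg hA.1.1 fun i => ?_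
  have := Finset.single_le_sum (fun j _ => hA.1.eigenvalues_nonneg j) (Finset.mem_univ i)
  linarith

end Spectral

/-! ### Relative entropy from the first-order behaviour of entropy -/

section RelativeEntropy

variable {d : Type*} [Fintype d] [DecidableEq d]

theorem IsDensity.convex {d : Type*} [Fintype d] {A B : Matrix d d ℂ} (hA : IsDensity A) (hB : IsDensity B) {t : ℝ}
    (h0 : 0 ≤ t) (h1 : t ≤ 1) : IsDensity (((1 - t : ℝ) : ℂ) • A + (t : ℂ) • B) := by
  refine ⟨(hA.1.smul ?_).add (hB.1.smul ?_), ?_⟩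
  · exact_mod_cast sub_nonneg.2 h1
  · exact_mod_cast h0
  · simp [trace_add, trace_smul, hA.2, hB.2]

/-- A first-order lower bound for the entropy of a mixture. -/
theorem le_entropy_mix {A B : Matrix d d ℂ} (hA : IsDensity A) (hB : IsDensity B) {t : ℝ}
    (h0 : 0 < t) (h1 : t ≤ 1) :
    (1 - t) * (entropy A - t ^ 2 * Fintype.card d) -
        t * (B * cfc (fun x => Real.log (x + (t + t ^ 2))) A).trace.re ≤
      entropy (((1 - t : ℝ) : ℂ) • A + (t : ℂ) • B) := by
  set C := ((1 - t : ℝ) : ℂ) • A + (t : ℂ) • B with hC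
  have hCd : IsDensity C := hA.convex hB h0.le h1
  have ht2 : 0 < t ^ 2 := by positivity
  -- The shift t² makes the logarithms those of positive definite matrices, and its cost t² · dim is
  -- o(t), so it disappears after division by t.
  have k1 := trace_mul_log_le hCd.1 ht2
  have k2 := klein_add hA hCd ht2
  -- Since B ≤ 1, the mixture satisfies C ≤ A + t. Monotonicity of log then replaces C by a shift of
  -- A, in whose eigenbasis everything is explicit.
  have hle : C + ((t ^ 2 : ℝ) : ℂ) • (1 : Matrix d d ℂ) ≤
      A + ((t + t ^ 2 : ℝ) : ℂ) • (1 : Matrix d d ℂ) := by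
    rw [Matrix.le_iff]
    have e : A + ((t + t ^ 2 : ℝ) : ℂ) • (1 : Matrix d d ℂ) -
        (C + ((t ^ 2 : ℝ) : ℂ) • (1 : Matrix d d ℂ)) = (t : ℂ) • A + (t : ℂ) • (1 - B) := by
      rw [hC]
      push_cast
      module
    rw [e]
    have ht : (0 : ℂ) ≤ (t : ℂ) := by exact_mod_cast h0.le
    exact (hA.1.smul ht).add ((Matrix.le_iff.1 hB.le_one).smul ht)
  have k3 := trace_mul_le_trace_mul hB.1
    (cfc_log_le_cfc_log (posDef_add_smul_one hCd.1 ht2) hle)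
  rw [cfc_add_const_any hA.1.1 Real.log (t + t ^ 2)] at k3
  have k4 : (C * cfc Real.log (C + ((t ^ 2 : ℝ) : ℂ) • (1 : Matrix d d ℂ))).trace.re =
      (1 - t) * (A * cfc Real.log (C + ((t ^ 2 : ℝ) : ℂ) • (1 : Matrix d d ℂ))).trace.re +
      t * (B * cfc Real.log (C + ((t ^ 2 : ℝ) : ℂ) • (1 : Matrix d d ℂ))).trace.re := by
    generalize cfc Real.log (C + ((t ^ 2 : ℝ) : ℂ) • (1 : Matrix d d ℂ)) = L
    rw [hC, add_mul, smul_mul_assoc, smul_mul_assoc, trace_add, trace_smul, trace_smul,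
      Complex.add_re, smul_eq_mul, smul_eq_mul, Complex.re_ofReal_mul, Complex.re_ofReal_mul]
  unfold entropy
  rw [k4] at k1
  have m1 := mul_le_mul_of_nonneg_left k2 (sub_nonneg.2 h1)
  have m2 := mul_le_mul_of_nonneg_left k3 h0.le
  linarith

theorem tendsto_mul_log_add {x m : ℝ} (h : m = 0 → x = 0) {l : Filter ℝ} {s : ℝ → ℝ}
    (hs : Tendsto s l (𝓝 0)) :
    Tendsto (fun t => x * Real.log (m + s t)) l (𝓝 (x * Real.log m)) := by
  by_cases hm : m = 0
  · simpa [h hm] using tendsto_const_nhds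
  · refine Tendsto.const_mul _ ?_
    have : Tendsto (fun t => m + s t) l (𝓝 m) := by simpa using hs.const_add m
    exact this.log hm

/-- If `H` satisfies a first-order upper bound at `A` in the direction of `B`, then the relative
entropy of `B` with respect to `A` is finite and bounded. -/
theorem relEntropy_of_entropy_mix_le {A B : Matrix d d ℂ} (hA : IsDensity A) (hB : IsDensity B)
    {K : ℝ} (hK : ∀ t : ℝ, 0 < t → t ≤ 1 →
      entropy (((1 - t : ℝ) : ℂ) • A + (t : ℂ) • B) ≤ (1 - t) * entropy A + t * K) :
    ∃ r : ℝ, relEntropy B A = (r : EReal) ∧ 0 ≤ r ∧ r ≤ K - entropy B := by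
  set U := (hA.1.1.eigenvectorUnitary : Matrix d d ℂ) with hU
  set m := hA.1.1.eigenvalues with hm
  have hm0 : ∀ j, 0 ≤ m j := hA.1.eigenvalues_nonneg
  have hpos : (star U * B * U).PosSemidef := hB.1.conjTranspose_mul_mul_same U
  set x : d → ℝ := fun j => ((star U * B * U) j j).re with hx
  have hx0 : ∀ j, 0 ≤ x j := fun j => (Complex.nonneg_iff.1 hpos.diag_nonneg).1
  have hxsum : ∑ j, x j = 1 := by
    have : (B * cfc (fun _ : ℝ => (1 : ℝ)) A).trace.re = ∑ j, x j * 1 :=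
      trace_mul_cfc hA.1.1 B _
    rw [cfc_real_const_one hA.1.1, mul_one, hB.2] at this
    simpa using this.symm
  have htr : ∀ f : ℝ → ℝ, (B * cfc f A).trace.re = ∑ j, x j * f (m j) := trace_mul_cfc hA.1.1 B
  have key : ∀ t : ℝ, 0 < t → t ≤ 1 →
      -(K + t * Fintype.card d) ≤ ∑ j, x j * Real.log (m j + (t + t ^ 2)) := by
    intro t h0 h1
    have a := le_entropy_mix hA hB h0 h1
    rw [htr] at a
    have b := a.trans (hK t h0 h1)
    have c : t * -(K + (1 - t) * t * Fintype.card d) ≤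
        t * ∑ j, x j * Real.log (m j + (t + t ^ 2)) := by linarith
    have c' := le_of_mul_le_mul_left c h0
    have : 0 ≤ t * t * (Fintype.card d : ℝ) := by positivity
    linarith
  have hs : Tendsto (fun t : ℝ => t + t ^ 2) (𝓝[>] 0) (𝓝 0) := by
    have : Continuous fun t : ℝ => t + t ^ 2 := by fun_prop
    simpa using (this.tendsto 0).mono_left nhdsWithin_le_nhds
  have hev : ∀ᶠ t in 𝓝[>] (0 : ℝ), 0 < t ∧ t ≤ 1 := by
    filter_upwards [Ioc_mem_nhdsGT (show (0 : ℝ) < 1 by norm_num)] with t ht using ht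
  -- If B had weight on the kernel of A, the term x j * log (t + t²) would tend to -∞. The other
  -- terms total at most log 3, as m i + t + t² ≤ 3, so `key` would fail for small t.
  have hsupp : ∀ j, m j = 0 → x j = 0 := by
    intro j hj
    by_contra hne
    have hxj : 0 < x j := lt_of_le_of_ne (hx0 j) (Ne.symm hne)
    have hmle : ∀ i, m i ≤ 1 := fun i => by
      rw [← hA.sum_eigenvalues]
      exact Finset.single_le_sum (fun j _ => hm0 j) (Finset.mem_univ i)
    have hbot : Tendsto (fun t : ℝ => x j * Real.log (t + t ^ 2) + Real.log 3) (𝓝[>] 0) atBot := by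
      refine Tendsto.atBot_add (Tendsto.const_mul_atBot hxj
        (Real.tendsto_log_nhdsGT_zero.comp
          (tendsto_nhdsWithin_iff.2 ⟨hs, ?_⟩))) tendsto_const_nhds
      filter_upwards [hev] with t ht
      have := ht.1
      simp only [Set.mem_Ioi]
      positivity
    have hb := hbot.eventually (eventually_lt_atBot (-(K + Fintype.card d)))
    obtain ⟨t, ⟨h0, h1⟩, hlt⟩ := (hev.and hb).exists
    have hk := key t h0 h1
    have h3 : ∑ i ∈ Finset.univ.erase j, x i * Real.log (m i + (t + t ^ 2)) ≤ Real.log 3 := by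
      calc _ ≤ ∑ i ∈ Finset.univ.erase j, x i * Real.log 3 := by
            refine Finset.sum_le_sum fun i _ => mul_le_mul_of_nonneg_left ?_ (hx0 i)
            refine Real.log_le_log ?_ ?_
            · have := hm0 i
              positivity
            · nlinarith [hmle i]
        _ ≤ 1 * Real.log 3 := by
            rw [← Finset.sum_mul]
            refine mul_le_mul_of_nonneg_right ?_ (Real.log_nonneg (by norm_num))
            rw [← hxsum]
            exact Finset.sum_le_sum_of_subset_of_nonneg (Finset.erase_subset _ _)
              fun i _ _ => hx0 i
        _ = _ := one_mul _
    rw [← Finset.add_sum_erase _ _ (Finset.mem_univ j), hj, zero_add] at hk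
    have : t * (Fintype.card d : ℝ) ≤ Fintype.card d :=
      mul_le_of_le_one_left (by positivity) h1
    linarith
  have hlim : Tendsto (fun t : ℝ => ∑ j, x j * Real.log (m j + (t + t ^ 2))) (𝓝[>] 0)
      (𝓝 (∑ j, x j * Real.log (m j))) :=
    tendsto_finsetSum _ fun j _ => tendsto_mul_log_add (hsupp j) hs
  have hcond : ∀ v : d → ℂ, A.mulVec v = 0 → B.mulVec v = 0 := by
    intro v hv
    have hUU : U * star U = 1 := by simp [hU]
    have hAd : A = U * diagonal (fun i => (m i : ℂ)) * star U := by
      have := cfc_eq_conj hA.1.1 (fun x => x)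
      rwa [cfc_real_id hA.1.1] at this
    have hsU : star U * U = 1 := by simp [hU]
    have h1 : diagonal (fun i => (m i : ℂ)) *ᵥ (star U *ᵥ v) = 0 := by
      have : star U *ᵥ (A *ᵥ v) = 0 := by rw [hv, mulVec_zero]
      rw [hAd, mulVec_mulVec, ← mul_assoc, ← mul_assoc, hsU, one_mul, ← mulVec_mulVec] at this
      exact this
    -- A zero diagonal entry of a positive semidefinite matrix kills its whole column.
    have hcol : ∀ i j, m j = 0 → (star U * B * U) i j = 0 := by
      intro i j hj
      have h0 : star (Pi.single j (1 : ℂ)) ⬝ᵥ ((star U * B * U) *ᵥ Pi.single j 1) = 0 := by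
        have : (star U * B * U) j j = 0 := by
          refine Complex.ext (hsupp j hj) ?_
          simpa using (Complex.nonneg_iff.1 (hpos.diag_nonneg (i := j))).2.symm
        simpa [mulVec_single, Pi.star_single] using this
      have := congrFun ((hpos.dotProduct_mulVec_zero_iff _).1 h0) i
      simpa [mulVec_single] using this
    have h2 : (star U * B * U) *ᵥ (star U *ᵥ v) = 0 := by
      ext i
      rw [mulVec, dotProduct, Pi.zero_apply]
      refine Finset.sum_eq_zero fun j _ => ?_
      have h1j := congrFun h1 j
      rw [mulVec_diagonal, Pi.zero_apply] at h1j
      rcases mul_eq_zero.1 h1j with h | h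
      · rw [hcol i j (by exact_mod_cast h), zero_mul]
      · rw [h, mul_zero]
    have h3 : U *ᵥ ((star U * B * U) *ᵥ (star U *ᵥ v)) = 0 := by rw [h2, mulVec_zero]
    rw [mulVec_mulVec, mulVec_mulVec] at h3
    have : U * (star U * B * U) * star U = B := by
      rw [← mul_assoc, ← mul_assoc, hUU, one_mul, mul_assoc, hUU, mul_one]
    rwa [this] at h3
  refine ⟨_, by rw [relEntropy, if_pos hcond], ?_, ?_⟩
  · have hk : ∀ᶠ t in 𝓝[>] (0 : ℝ), ∑ j, x j * Real.log (m j + (t + t ^ 2)) ≤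
        (B * cfc Real.log B).trace.re + (t + t ^ 2) * Fintype.card d := by
      filter_upwards [hev] with t ht
      have h0 := ht.1
      have := klein_add hB hA (s := t + t ^ 2) (by positivity)
      rw [cfc_add_const_any hA.1.1, htr] at this
      linarith
    have := le_of_tendsto_of_tendsto hlim ((hs.mul_const _).const_add _) hk
    rw [trace_sub, Complex.sub_re, htr]
    linarith
  · have hk : ∀ᶠ t in 𝓝[>] (0 : ℝ), -(K + t * Fintype.card d) ≤
        ∑ j, x j * Real.log (m j + (t + t ^ 2)) := by
      filter_upwards [hev] with t ht using key t ht.1 ht.2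
    have h0 : Tendsto (fun t : ℝ => -(K + t * Fintype.card d)) (𝓝[>] 0) (𝓝 (-(K + 0))) := by
      have : Continuous fun t : ℝ => -(K + t * Fintype.card d) := by fun_prop
      simpa using (this.tendsto 0).mono_left nhdsWithin_le_nhds
    have := le_of_tendsto_of_tendsto h0 hlim hk
    rw [trace_sub, Complex.sub_re, htr]
    unfold entropy
    linarith

end RelativeEntropy

/-! ### Hypothesis-testing bound and weak converse -/

section Converse

variable {d : Type*} [Fintype d] [DecidableEq d]

open scoped Matrix.Norms.L2Operator in
theorem cfc_exp_add_of_commute {A B : Matrix d d ℂ} (hA : A.IsHermitian) (hB : B.IsHermitian)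
    (h : Commute A B) : cfc Real.exp (A + B) = cfc Real.exp A * cfc Real.exp B := by
  rw [CFC.real_exp_eq_normedSpace_exp (hA.add hB).isSelfAdjoint,
    CFC.real_exp_eq_normedSpace_exp hA.isSelfAdjoint,
    CFC.real_exp_eq_normedSpace_exp hB.isSelfAdjoint]
  exact Matrix.exp_add_of_commute A B h

open scoped Matrix.Norms.L2Operator in
theorem cfc_exp_cfc_log {A : Matrix d d ℂ} (hA : A.PosDef) :
    cfc Real.exp (cfc Real.log A) = A := by
  rw [CFC.real_exp_eq_normedSpace_exp (cfc_predicate _ _)]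
  exact CFC.exp_log A hA.isStrictlyPositive

/-- Only the values at 0 and 1 matter, since an eigenvalue of an idempotent satisfies x(x - 1) = 0.
-/
theorem cfc_exp_smul_projection {P : Matrix d d ℂ} (hP : P.IsHermitian) (hPP : P * P = P)
    {c : ℝ} (hc : 0 < c) :
    cfc Real.exp ((Real.log c : ℂ) • P) = 1 + ((c - 1 : ℝ) : ℂ) • P := by
  have hcont : ∀ (h : ℝ → ℝ) (S : Set ℝ), S.Finite → ContinuousOn h S :=
    fun h S hS => hS.continuousOn h
  have hsm : ∀ r : ℝ, (r : ℂ) • P = cfc (fun x : ℝ => r * x) P := by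
    intro r
    rw [cfc_const_mul r (fun x : ℝ => x) P (hcont _ _ (Set.toFinite _)), cfc_real_id hP]
    ext i j
    simp
  have hspec : ∀ x ∈ spectrum ℝ P, x = 0 ∨ x = 1 := by
    intro x hx
    rw [hP.spectrum_real_eq_range_eigenvalues] at hx
    obtain ⟨i, rfl⟩ := hx
    have hv := hP.mulVec_eigenvectorBasis i
    have h2 : P *ᵥ (P *ᵥ ⇑(hP.eigenvectorBasis i)) = P *ᵥ ⇑(hP.eigenvectorBasis i) := by
      rw [mulVec_mulVec, hPP]
    rw [hv, mulVec_smul, hv, smul_smul, ← sub_eq_zero, ← sub_smul] at h2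
    have hne : (⇑(hP.eigenvectorBasis i) : d → ℂ) ≠ 0 := by
      intro h0
      have : hP.eigenvectorBasis i = 0 := by
        ext j
        exact congrFun h0 j
      have hn := hP.eigenvectorBasis.orthonormal.1 i
      rw [this, norm_zero] at hn
      exact zero_ne_one hn
    have h3 := (smul_eq_zero.1 h2).resolve_right hne
    have h4 : hP.eigenvalues i * (hP.eigenvalues i - 1) = 0 := by linarith
    rcases mul_eq_zero.1 h4 with h | h
    · exact Or.inl h
    · exact Or.inr (by linarith)
  rw [hsm, hsm, ← cfc_comp' Real.exp (fun x => Real.log c * x) P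
    (hcont _ _ ((Set.toFinite _).image _)) (hcont _ _ (Set.toFinite _)) hP.isSelfAdjoint,
    ← cfc_real_const_one hP, ← cfc_add _ _ _ (hcont _ _ (Set.toFinite _))
      (hcont _ _ (Set.toFinite _))]
  refine cfc_congr fun x hx => ?_
  rcases hspec x hx with rfl | rfl
  · simp
  · simp [Real.exp_log hc]

/-- A lower bound for the relative entropy from a projective test. -/
theorem le_relEntropy_of_projection {A S P : Matrix d d ℂ} (hA : IsDensity A) (hS : S.PosDef)
    (hP : P.IsHermitian) (hPP : P * P = P) {c : ℝ} (hc : 0 < c) :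
    Real.log c * (A * P).trace.re + 1 - 2 * S.trace.re - 2 * (c - 1) * (S * P).trace.re ≤
      (A * cfc Real.log A).trace.re - (A * cfc Real.log S).trace.re := by
  -- R is the reflection 2P - 1. S + RSR is twice the pinching of S by P: it dominates S and
  -- commutes with P. Klein's inequality with exponent log X + (log c) P then has an explicit
  -- exponential, X(1 + (c - 1)P).
  set R : Matrix d d ℂ := P + P - 1 with hR
  have hRH : Rᴴ = R := by
    rw [hR, conjTranspose_sub, conjTranspose_add, hP.eq, conjTranspose_one]
  have hRR : R * R = 1 := by
    rw [hR]
    simp only [mul_sub, sub_mul, mul_add, add_mul, hPP, mul_one, one_mul]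
    abel
  have hRP : R * P = P * R := by
    rw [hR]
    simp only [mul_sub, sub_mul, mul_add, add_mul, hPP, mul_one, one_mul]
  have hps : (R * S * R).PosSemidef := by
    have := hS.posSemidef.mul_mul_conjTranspose_same R
    rwa [hRH] at this
  obtain ⟨X, hX⟩ : ∃ X : Matrix d d ℂ, X = S + R * S * R := ⟨_, rfl⟩
  have hXpd : X.PosDef := hX ▸ hS.add_posSemidef hps
  have hle : S ≤ X := by
    rw [Matrix.le_iff, hX, add_sub_cancel_left]
    exact hps
  have hcommR : Commute X R := by
    change X * R = R * X
    rw [hX, add_mul, mul_add, mul_assoc (R * S), hRR, mul_one, ← mul_assoc, ← mul_assoc, hRR,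
      one_mul, add_comm]
  have hcommP : Commute X P := by
    have h2 : P = (1 / 2 : ℂ) • (1 + R) := by
      rw [hR]
      module
    rw [h2]
    exact ((Commute.one_right X).add_right hcommR).smul_right _
  have hlogH : (cfc Real.log X).IsHermitian := cfc_predicate _ _
  have hcP : ((Real.log c : ℂ) • P).IsHermitian := by
    rw [IsHermitian, conjTranspose_smul, hP.eq]
    simp
  have hcomm : Commute (cfc Real.log X) ((Real.log c : ℂ) • P) :=
    (Commute.cfc_real hcommP _).smul_right _
  have hk := klein hA.1 (hlogH.add hcP) (fun x => x)
  rw [cfc_real_id (hlogH.add hcP), cfc_exp_add_of_commute hlogH hcP hcomm, cfc_exp_cfc_log hXpd,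
    cfc_exp_smul_projection hP hPP hc, mul_add, mul_add, mul_one, mul_smul_comm, mul_smul_comm,
    trace_add, trace_add, trace_smul, trace_smul, Complex.add_re, Complex.add_re, smul_eq_mul,
    smul_eq_mul, Complex.re_ofReal_mul, Complex.re_ofReal_mul, hA.2, Complex.one_re] at hk
  have t1 : X.trace = S.trace + S.trace := by
    rw [hX, trace_add, trace_mul_comm, ← mul_assoc, hRR, one_mul]
  have t2 : (X * P).trace = (S * P).trace + (S * P).trace := by
    rw [hX, add_mul, trace_add, mul_assoc (R * S), hRP, ← mul_assoc, trace_mul_comm (R * S * P) R,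
      ← mul_assoc, ← mul_assoc, hRR, one_mul]
  have hmono := trace_mul_le_trace_mul hA.1 (cfc_log_le_cfc_log hS hle)
  rw [t1, t2, Complex.add_re, Complex.add_re] at hk
  linarith

theorem mem_Icc_of_mem_spectrum {A : Matrix d d ℂ} (hA : A.PosSemidef) (hA1 : A ≤ 1) {x : ℝ}
    (hx : x ∈ spectrum ℝ A) : 0 ≤ x ∧ x ≤ 1 := by
  have hcont : ∀ h : ℝ → ℝ, ContinuousOn h (spectrum ℝ A) := fun h =>
    (Set.toFinite _).continuousOn h
  refine ⟨?_, ?_⟩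
  · rw [hA.1.spectrum_real_eq_range_eigenvalues] at hx
    obtain ⟨i, rfl⟩ := hx
    exact hA.eigenvalues_nonneg i
  · have h1 : cfc (fun x : ℝ => x) A ≤ cfc (fun _ : ℝ => (1 : ℝ)) A := by
      rwa [cfc_real_id hA.1, cfc_real_const_one hA.1]
    exact (cfc_le_iff _ _ A (hcont _) (hcont _) hA.1.isSelfAdjoint).1 h1 x hx

/-- Rounding the eigenvalues of T at 1/2 at most doubles both the test and its complement. This is
the source of the factor 2 in 1 - 2ε. -/
theorem exists_projection {T : Matrix d d ℂ} (hT : T.PosSemidef) (hT1 : T ≤ 1) :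
    ∃ P : Matrix d d ℂ, P.IsHermitian ∧ P * P = P ∧ P ≤ (2 : ℝ) • T ∧
      1 - P ≤ (2 : ℝ) • (1 - T) ∧ P ≤ 1 := by
  have hcont : ∀ h : ℝ → ℝ, ContinuousOn h (spectrum ℝ T) := fun h =>
    (Set.toFinite _).continuousOn h
  set f : ℝ → ℝ := fun x => if 1 / 2 ≤ x then 1 else 0 with hf
  have hid := cfc_real_id hT.1
  have hone := cfc_real_const_one hT.1
  have h0 : ∀ x ∈ spectrum ℝ T, 0 ≤ x := fun x hx => (mem_Icc_of_mem_spectrum hT hT1 hx).1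
  have hle : ∀ x ∈ spectrum ℝ T, x ≤ 1 := fun x hx => (mem_Icc_of_mem_spectrum hT hT1 hx).2
  refine ⟨cfc f T, cfc_predicate _ _, ?_, ?_, ?_, ?_⟩
  · rw [cfc_mul_any]
    refine cfc_congr fun x _ => ?_
    simp [hf]
  · conv_rhs => rw [← hid]
    rw [← cfc_smul (2 : ℝ) (fun x : ℝ => x) T (hcont _)]
    refine cfc_mono (fun x hx => ?_) (hcont _) (hcont _)
    have := h0 x hx
    simp only [hf, smul_eq_mul]
    split_ifs <;> linarith
  · conv_lhs => rw [← hone]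
    have : (1 : Matrix d d ℂ) - T = cfc (fun x : ℝ => 1 - x) T := by
      rw [cfc_sub (fun _ : ℝ => (1 : ℝ)) (fun x => x) T (hcont _) (hcont _), hone, hid]
    rw [this, ← cfc_sub _ _ T (hcont _) (hcont _), ← cfc_smul (2 : ℝ) _ T (hcont _)]
    refine cfc_mono (fun x hx => ?_) (hcont _) (hcont _)
    have := hle x hx
    simp only [hf, smul_eq_mul]
    split_ifs <;> linarith
  · conv_rhs => rw [← hone]
    refine cfc_mono (fun x hx => ?_) (hcont _) (hcont _)
    simp only [hf]
    split_ifs <;> norm_num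

theorem trace_re_mono {A B : Matrix d d ℂ} (h : A ≤ B) : A.trace.re ≤ B.trace.re := by
  have := trace_mul_le_trace_mul PosSemidef.one h
  rwa [one_mul, one_mul] at this

/-- A lower bound for the relative entropy from a test. -/
theorem le_relEntropy_of_test {A S T : Matrix d d ℂ} (hA : IsDensity A) (hS : IsDensity S)
    (hT : T.PosSemidef) (hT1 : T ≤ 1) {c s : ℝ} (hc : 1 ≤ c) (hs : 0 < s) :
    Real.log c * (2 * (A * T).trace.re - 1) - 1 - 4 * c * (S * T).trace.re
        - 2 * c * (s * Fintype.card d) ≤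
      (A * cfc Real.log A).trace.re - (A * cfc Real.log (S + (s : ℂ) • 1)).trace.re := by
  obtain ⟨P, hP, hPP, h2T, h2, h1⟩ := exists_projection hT hT1
  refine le_trans ?_ (le_relEntropy_of_projection hA (posDef_add_smul_one hS.1 hs) hP hPP
    (by linarith : 0 < c))
  have a1 := trace_mul_le_trace_mul hA.1 h2
  rw [mul_sub, mul_smul_comm, mul_sub, mul_one, trace_sub, trace_smul, trace_sub, Complex.sub_re,
    Complex.smul_re, Complex.sub_re, hA.2, Complex.one_re, smul_eq_mul] at a1
  have a2 := trace_mul_le_trace_mul hS.1 h2T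
  rw [mul_smul_comm, trace_smul, Complex.smul_re, smul_eq_mul] at a2
  have a3 := trace_re_mono h1
  rw [trace_one, Complex.natCast_re] at a3
  rw [trace_add_smul_one, hS.2, Complex.one_re, add_mul, trace_add, smul_mul_assoc, one_mul,
    trace_smul, Complex.add_re, smul_eq_mul, Complex.re_ofReal_mul]
  have b1 := mul_le_mul_of_nonneg_left a1 (Real.log_nonneg hc)
  have a4 := mul_le_mul_of_nonneg_left a3 hs.le
  have b2 := mul_le_mul_of_nonneg_left (add_le_add a2 a4)
    (by linarith : (0 : ℝ) ≤ 2 * (c - 1))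
  have a5 := trace_mul_nonneg hS.1 hT
  linarith

/-- A weak converse bound: the Holevo information of a code with small average error is almost
`log M`. -/
theorem converse_bound {M : ℕ} (hM : 0 < M) {W E : Fin M → Matrix d d ℂ}
    (hW : ∀ m, IsDensity (W m)) (hE : ∀ m, (E m).PosSemidef) (hsum : ∑ m, E m = 1) {ε : ℝ}
    (hε : 1 - ε ≤ 1 / (M : ℝ) * ∑ m, (W m * E m).trace.re) :
    (1 - 2 * ε) * Real.log M - 7 ≤
      entropy ((1 / (M : ℂ)) • ∑ m, W m) - 1 / (M : ℝ) * ∑ m, entropy (W m) := by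
  have hM' : (0 : ℝ) < M := by exact_mod_cast hM
  have hM1 : (1 : ℝ) ≤ M := by exact_mod_cast hM
  set S := (1 / (M : ℂ)) • ∑ m, W m with hSdef
  have hS : IsDensity S := by
    refine ⟨PosSemidef.smul (posSemidef_sum _ fun m _ => (hW m).1) ?_, ?_⟩
    · simp
    · have : (M : ℂ) ≠ 0 := by exact_mod_cast hM.ne'
      simp [S, trace_smul, trace_sum, (hW _).2, this]
  have hd : (0 : ℝ) < Fintype.card d := by
    have := hS.nonempty
    exact_mod_cast Fintype.card_pos
  have hE1 : ∀ m, E m ≤ 1 := by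
    intro m
    rw [← hsum]
    exact Finset.single_le_sum (f := E) (fun i _ => Matrix.nonneg_iff_posSemidef.2 (hE i))
      (Finset.mem_univ m)
  have havg : ∀ X : Matrix d d ℂ, (S * X).trace.re = 1 / (M : ℝ) * ∑ m, (W m * X).trace.re := by
    intro X
    rw [hSdef, smul_mul_assoc, trace_smul, Finset.sum_mul, trace_sum, smul_eq_mul,
      ← Complex.re_sum, ← Complex.re_ofReal_mul]
    push_cast
    rfl
  -- The Holevo information is the average of D(W m‖S). Each term is tested by E m with c = M. This
  -- s makes the regularization cost 2; the average of 4M Tr(S E m) is 4; with the remaining 1 the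
  -- total is 7.
  set s : ℝ := 1 / (M * Fintype.card d) with hs
  have hs0 : 0 < s := by positivity
  have h := fun m => le_relEntropy_of_test (hW m) hS (hE m) (hE1 m) hM1 hs0
  have hsc : 2 * (M : ℝ) * (s * Fintype.card d) = 2 := by
    rw [hs]
    field_simp
  have hsumT : ∑ m, (S * E m).trace.re = 1 := by
    rw [← Complex.re_sum, ← trace_sum, ← Finset.mul_sum, hsum, mul_one, hS.2, Complex.one_re]
  have k := trace_mul_log_le hS.1 hs0
  have k2 := havg (cfc Real.log (S + (s : ℂ) • 1))
  have hh := Finset.sum_le_sum fun m (_ : m ∈ Finset.univ) => h m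
  simp only [hsc, Finset.sum_sub_distrib, ← Finset.mul_sum, hsumT, Finset.sum_const,
    Finset.card_univ, Fintype.card_fin, nsmul_eq_mul] at hh
  have hh2 := mul_le_mul_of_nonneg_left hh (by positivity : (0 : ℝ) ≤ 1 / M)
  have hlog := mul_le_mul_of_nonneg_left hε (Real.log_nonneg hM1)
  have e1 : 1 / (M : ℝ) * M = 1 := by field_simp
  simp only [entropy, Finset.sum_neg_distrib]
  simp only [mul_sub] at hh2
  have e2 : 1 / (M : ℝ) * (4 * M * 1) = 4 := by field_simp
  have e3 : 1 / (M : ℝ) * (M * 2) = 2 := by field_simp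
  have e4 : 1 / (M : ℝ) * (M * 1) = 1 := by field_simp
  rw [e2, e3, e4] at hh2
  have e5 : 1 / (M : ℝ) * (Real.log M * (2 * ∑ m, (W m * E m).trace.re)) =
      2 * (Real.log M * (1 / (M : ℝ) * ∑ m, (W m * E m).trace.re)) := by ring
  have e6 : 1 / (M : ℝ) * (Real.log M * (M * 1)) = Real.log M := by field_simp
  linarith

end Converse

/-! ### One-shot greedy coding and the Chernoff bound -/

section Greedy

variable {d : Type*} [Fintype d] [DecidableEq d]

theorem conj_le_conj {d : Type*} [Fintype d] {A B K : Matrix d d ℂ} (hK : K.IsHermitian) (h : A ≤ B) :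
    K * A * K ≤ K * B * K := by
  rw [Matrix.le_iff] at h ⊢
  have := h.mul_mul_conjTranspose_same K
  rwa [hK.eq, mul_sub, sub_mul] at this

/-- The square root `K` of `1 - S`. -/
theorem exists_sqrt_one_sub {S : Matrix d d ℂ} (hS : S.PosSemidef) (hS1 : S ≤ 1) :
    ∃ K : Matrix d d ℂ, K.IsHermitian ∧ K * K = 1 - S ∧ (1 - K) * (1 - K) ≤ S := by
  have hcont : ∀ h : ℝ → ℝ, ContinuousOn h (spectrum ℝ S) := fun h =>
    (Set.toFinite _).continuousOn h
  have hid := cfc_real_id hS.1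
  have hone := cfc_real_const_one hS.1
  have h0 : ∀ x ∈ spectrum ℝ S, 0 ≤ x := fun x hx => (mem_Icc_of_mem_spectrum hS hS1 hx).1
  have hle : ∀ x ∈ spectrum ℝ S, x ≤ 1 := fun x hx => (mem_Icc_of_mem_spectrum hS hS1 hx).2
  refine ⟨cfc (fun x => √(1 - x)) S, cfc_predicate _ _, ?_, ?_⟩
  · have : (1 : Matrix d d ℂ) - S = cfc (fun x : ℝ => 1 - x) S := by
      rw [cfc_sub (fun _ : ℝ => (1 : ℝ)) (fun x => x) S (hcont _) (hcont _), hone, hid]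
    rw [cfc_mul_any, this]
    refine cfc_congr fun x hx => ?_
    exact Real.mul_self_sqrt (sub_nonneg.2 (hle x hx))
  · conv_rhs => rw [← hid]
    conv_lhs => rw [← hone]
    rw [← cfc_sub _ _ S (hcont _) (hcont _), cfc_mul_any]
    refine cfc_mono (fun x hx => ?_) (hcont _) (hcont _)
    have h1 := hle x hx
    have h2 := h0 x hx
    have h3 := Real.mul_self_sqrt (sub_nonneg.2 h1)
    have h4 := Real.sqrt_nonneg (1 - x)
    have h5 : √(1 - x) ≤ 1 := Real.sqrt_le_one.2 (by linarith)
    nlinarith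

/-- The gentle measurement bound. -/
theorem le_conj_add {Q S K : Matrix d d ℂ} (hQ : Q.PosSemidef) (hQ1 : Q ≤ 1) (hK : K.IsHermitian)
    (hJ : (1 - K) * (1 - K) ≤ S) {ε : ℝ} (hε : 0 < ε) :
    Q ≤ (1 + ε) • (K * Q * K) + (1 + 1 / ε) • S := by
  have hJH : (1 - K).IsHermitian := isHermitian_one.sub hK
  have h1 : (1 - K) * Q * (1 - K) ≤ S := by
    have := conj_le_conj hJH hQ1
    rw [mul_one] at this
    exact this.trans hJ
  -- With J = 1 - K and Q = (K + J)Q(K + J), the cross terms are at most εKQK + JQJ/ε, by expanding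
  -- (εK - J)Q(εK - J) ≥ 0; finally JQJ ≤ J² ≤ S.
  have hL : (ε • K - (1 - K)).IsHermitian := by
    refine IsHermitian.sub ?_ hJH
    rw [IsHermitian, conjTranspose_smul, hK.eq]
    simp
  have h2 : ((ε • K - (1 - K)) * Q * (ε • K - (1 - K))).PosSemidef := by
    have := hQ.mul_mul_conjTranspose_same (ε • K - (1 - K))
    rwa [hL.eq] at this
  have h3 : (1 + ε) • (K * Q * K) + (1 + 1 / ε) • S - Q =
      (1 / ε) • ((ε • K - (1 - K)) * Q * (ε • K - (1 - K))) +
        (1 + 1 / ε) • (S - (1 - K) * Q * (1 - K)) := by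
    simp only [mul_sub, sub_mul, mul_one, one_mul, smul_mul_assoc, mul_smul_comm]
    match_scalars <;> field_simp <;> ring
  rw [Matrix.le_iff, h3]
  exact (h2.smul (by positivity)).add ((Matrix.le_iff.1 h1).smul (by positivity))

variable {X : Type*} [Fintype X]

/-- Feinstein's argument. Let S be the sum of the decoders found so far and K = √(1 - S). The
candidate KQ_yK fits, since it is at most K² = 1 - S. If it failed for every y, averaging the gentle
measurement bound over q would give 1 - δ ≤ (1 + ε)(1 - ε) + (1 + 1/ε)(κMR + δ), contrary to the
size condition. The trace bound is carried along to control κ Tr S. -/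
theorem greedy_code {q : X → ℝ} {W Q : X → Matrix d d ℂ} {R δ κ ε : ℝ}
    (hq : ∀ x, 0 ≤ q x) (hq1 : ∑ x, q x = 1) (hW : ∀ x, IsDensity (W x))
    (hQ : ∀ x, (Q x).PosSemidef) (hQ1 : ∀ x, Q x ≤ 1) (hR : ∀ x, (Q x).trace.re ≤ R)
    (hδ : 1 - δ ≤ ∑ x, q x * (W x * Q x).trace.re) (hκ : 0 ≤ κ) (hR0 : 0 ≤ R)
    (hσ : ∀ S : Matrix d d ℂ, S.PosSemidef → S ≤ 1 →
      ∑ x, q x * (W x * S).trace.re ≤ κ * S.trace.re + δ) (hε : 0 < ε) :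
    ∀ M : ℕ, (1 + 1 / ε) * (κ * (M * R) + δ) < ε ^ 2 - δ →
      ∃ (x : Fin M → X) (E : Fin M → Matrix d d ℂ), (∀ m, (E m).PosSemidef) ∧ ∑ m, E m ≤ 1 ∧
        (∑ m, E m).trace.re ≤ M * R ∧ ∀ m, 1 - ε ≤ (W (x m) * E m).trace.re := by
  intro M
  induction M with
  | zero =>
    intro _
    exact ⟨Fin.elim0, Fin.elim0, fun m => m.elim0, by simp,
      by simp, fun m => m.elim0⟩
  | succ M ih =>
    intro hM
    have hε' : 0 < 1 + 1 / ε := by positivity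
    have hM' : (1 + 1 / ε) * (κ * (M * R) + δ) < ε ^ 2 - δ := by
      refine lt_of_le_of_lt ?_ hM
      have : (M : ℝ) ≤ (M + 1 : ℕ) := by push_cast; linarith
      gcongr
    obtain ⟨x, E, hE, hS1, htr, hx⟩ := ih hM'
    set S := ∑ m, E m with hSdef
    have hS : S.PosSemidef := posSemidef_sum _ fun m _ => hE m
    obtain ⟨K, hK, hKK, hJ⟩ := exists_sqrt_one_sub hS hS1
    obtain ⟨y, hy⟩ : ∃ y, 1 - ε ≤ (W y * (K * Q y * K)).trace.re := by
      by_contra! hcon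
      have h1 : ∀ y, (W y * Q y).trace.re ≤ (1 + ε) * (1 - ε) +
          (1 + 1 / ε) * (W y * S).trace.re := by
        intro y
        have h := trace_mul_le_trace_mul (hW y).1 (le_conj_add (hQ y) (hQ1 y) hK hJ hε)
        rw [mul_add, mul_smul_comm, mul_smul_comm, trace_add, trace_smul, trace_smul,
          Complex.add_re, Complex.smul_re, Complex.smul_re, smul_eq_mul, smul_eq_mul] at h
        have := mul_le_mul_of_nonneg_left (hcon y).le (by linarith : 0 ≤ 1 + ε)
        linarith
      have h2 : ∑ y, q y * (W y * Q y).trace.re ≤ (1 + ε) * (1 - ε) +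
          (1 + 1 / ε) * ∑ y, q y * (W y * S).trace.re := by
        calc _ ≤ ∑ y, q y * ((1 + ε) * (1 - ε) + (1 + 1 / ε) * (W y * S).trace.re) :=
              Finset.sum_le_sum fun y _ => mul_le_mul_of_nonneg_left (h1 y) (hq y)
          _ = _ := by
            simp only [mul_add, Finset.sum_add_distrib, ← Finset.sum_mul, hq1, one_mul,
              Finset.mul_sum]
            congr 1
            refine Finset.sum_congr rfl fun y _ => by ring
      have h3 : (1 + 1 / ε) * ∑ y, q y * (W y * S).trace.re ≤
          (1 + 1 / ε) * (κ * (M * R) + δ) := by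
        refine mul_le_mul_of_nonneg_left ((hσ S hS hS1).trans ?_) hε'.le
        gcongr
      nlinarith
    have hT : (K * Q y * K).PosSemidef := by
      have := (hQ y).mul_mul_conjTranspose_same K
      rwa [hK.eq] at this
    refine ⟨Fin.snoc x y, Fin.snoc E (K * Q y * K), ?_, ?_, ?_, ?_⟩
    · refine Fin.lastCases ?_ fun m => ?_
      · simpa using hT
      · simpa using hE m
    · rw [Fin.sum_univ_castSucc]
      simp only [Fin.snoc_castSucc, Fin.snoc_last]
      have := conj_le_conj hK (hQ1 y)
      rw [mul_one, hKK] at this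
      rw [← hSdef]
      calc S + K * Q y * K ≤ S + (1 - S) := by gcongr
        _ = 1 := by abel
    · rw [Fin.sum_univ_castSucc]
      simp only [Fin.snoc_castSucc, Fin.snoc_last]
      rw [← hSdef, trace_add, Complex.add_re, trace_mul_comm, ← mul_assoc, hKK, sub_mul, one_mul,
        trace_sub, Complex.sub_re]
      have h1 := trace_mul_nonneg hS (hQ y)
      have h2 := hR y
      push_cast
      linarith
    · refine Fin.lastCases ?_ fun m => ?_
      · simpa using hy
      · simpa using hx m

/-- One-shot coding for a classical-quantum channel. -/
theorem exists_code {q : X → ℝ} {W Q : X → Matrix d d ℂ} {R δ κ ε : ℝ}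
    (hq : ∀ x, 0 ≤ q x) (hq1 : ∑ x, q x = 1) (hW : ∀ x, IsDensity (W x))
    (hQ : ∀ x, (Q x).PosSemidef) (hQ1 : ∀ x, Q x ≤ 1) (hR : ∀ x, (Q x).trace.re ≤ R)
    (hδ : 1 - δ ≤ ∑ x, q x * (W x * Q x).trace.re) (hκ : 0 ≤ κ) (hR0 : 0 ≤ R)
    (hσ : ∀ S : Matrix d d ℂ, S.PosSemidef → S ≤ 1 →
      ∑ x, q x * (W x * S).trace.re ≤ κ * S.trace.re + δ) (hε : 0 < ε)
    {M : ℕ} (hM0 : 0 < M) (hM : (1 + 1 / ε) * (κ * (M * R) + δ) < ε ^ 2 - δ) :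
    ∃ (x : Fin M → X) (E : Fin M → Matrix d d ℂ), (∀ m, (E m).PosSemidef) ∧ ∑ m, E m = 1 ∧
      ∀ m, 1 - ε ≤ (W (x m) * E m).trace.re := by
  obtain ⟨x, E, hE, hS1, -, hx⟩ := greedy_code hq hq1 hW hQ hQ1 hR hδ hκ hR0 hσ hε M hM
  -- The unused part of the identity goes to the first message, which can only raise its success
  -- probability.
  have hrest : ∀ m : Fin M, (if m = ⟨0, hM0⟩ then 1 - ∑ m, E m else 0).PosSemidef := by
    intro m
    split_ifs
    · exact Matrix.le_iff.1 hS1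
    · exact PosSemidef.zero
  refine ⟨x, fun m => E m + if m = ⟨0, hM0⟩ then 1 - ∑ m, E m else 0,
    fun m => (hE m).add (hrest m), ?_, fun m => ?_⟩
  · rw [Finset.sum_add_distrib, Finset.sum_ite_eq' Finset.univ]
    simp
  · rw [mul_add, trace_add, Complex.add_re]
    have := trace_mul_nonneg (hW (x m)).1 (hrest m)
    linarith [hx m]

end Greedy

/-- The Chernoff bound for independent identically distributed variables. -/
theorem chernoff {Z : Type*} [Fintype Z] {p f : Z → ℝ} {c : ℝ} (hp : ∀ z, 0 ≤ p z)
    (hp1 : ∑ z, p z = 1) (hc : ∑ z, p z * f z < c) :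
    ∃ r : ℝ, 0 ≤ r ∧ r < 1 ∧ ∀ m : ℕ, ∑ z : Fin m → Z,
      (if m * c ≤ ∑ i, f (z i) then ∏ i, p (z i) else 0) ≤ r ^ m := by
  -- This moment generating function has φ 0 = 1 and negative slope at 0, so φ t < 1 for some t > 0;
  -- that value serves as r.
  set φ : ℝ → ℝ := fun t => ∑ z, p z * Real.exp (t * (f z - c)) with hφ
  have hder : HasDerivAt φ (∑ z, p z * (f z - c)) 0 := by
    refine HasDerivAt.fun_sum fun z _ => HasDerivAt.const_mul _ ?_
    have := ((hasDerivAt_id (0 : ℝ)).mul_const (f z - c)).exp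
    simpa using this
  have hneg : ∑ z, p z * (f z - c) < 0 := by
    simp only [mul_sub, Finset.sum_sub_distrib, ← Finset.sum_mul, hp1, one_mul]
    linarith
  have h0 : φ 0 = 1 := by simp [hφ, hp1]
  obtain ⟨t, ht0, ht⟩ : ∃ t : ℝ, 0 < t ∧ φ t < 1 := by
    have hsl := (hasDerivAt_iff_tendsto_slope.1 hder).eventually (gt_mem_nhds hneg)
    have hsl' : ∀ᶠ t in 𝓝[>] (0 : ℝ), slope φ 0 t < 0 :=
      hsl.filter_mono (nhdsWithin_mono _ fun x hx => ne_of_gt hx)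
    obtain ⟨t, h1, h2⟩ := (hsl'.and self_mem_nhdsWithin).exists
    have h2' : 0 < t := h2
    refine ⟨t, h2', ?_⟩
    rw [slope_def_field, h0, sub_zero, div_neg_iff] at h1
    rcases h1 with h | h <;> linarith [h.1, h.2]
  refine ⟨φ t, Finset.sum_nonneg fun z _ => mul_nonneg (hp z) (Real.exp_pos _).le, ht, ?_⟩
  intro m
  have : φ t ^ m = ∑ z : Fin m → Z, ∏ i, (p (z i) * Real.exp (t * (f (z i) - c))) := by
    exact Fintype.sum_pow (fun z => p z * Real.exp (t * (f z - c))) m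
  rw [this]
  refine Finset.sum_le_sum fun z _ => ?_
  have hnn : 0 ≤ ∏ i, p (z i) := Finset.prod_nonneg fun i _ => hp _
  rw [Finset.prod_mul_distrib, ← Real.exp_sum]
  split_ifs with h
  · refine le_mul_of_one_le_right hnn (Real.one_le_exp ?_)
    rw [← Finset.mul_sum, Finset.sum_sub_distrib]
    simp only [Finset.sum_const, Finset.card_univ, Fintype.card_fin, nsmul_eq_mul]
    exact mul_nonneg ht0.le (by linarith)
  · exact mul_nonneg hnn (Real.exp_pos _).le

/-! ### Eigenvalue cut-offs for explicitly diagonalized states -/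

section Diagonalized

variable {d : Type*} [Fintype d] [DecidableEq d]

theorem trace_conj_diagonal_mul {U : Matrix d d ℂ} (v : d → ℝ) (S : Matrix d d ℂ) :
    (U * diagonal (fun i => (v i : ℂ)) * star U * S).trace.re =
      ∑ j, v j * ((star U * S * U) j j).re := by
  rw [mul_assoc, trace_mul_comm, ← mul_assoc, ← trace_mul_comm, trace, Complex.re_sum]
  refine Finset.sum_congr rfl fun j _ => ?_
  rw [diag_apply, diagonal_mul, Complex.re_ofReal_mul]

/-- The diagonal entries of S in the basis U lie in [0, 1]: eigenvalues up to κ cost κ Tr S and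
larger ones at most their own mass. This supplies hypothesis `hσ` of `exists_code`, so no typical
projection of the average state is needed. -/
theorem trace_le_of_conj_diagonal {U : Matrix d d ℂ} (hU : U * star U = 1) {v : d → ℝ}
    (hv : ∀ j, 0 ≤ v j) {S : Matrix d d ℂ} (hS : S.PosSemidef) (hS1 : S ≤ 1) {κ : ℝ}
    (hκ : 0 ≤ κ) :
    (U * diagonal (fun i => (v i : ℂ)) * star U * S).trace.re ≤
      κ * S.trace.re + ∑ j, if κ < v j then v j else 0 := by
  have hU' : star U * U = 1 := mul_eq_one_comm.1 hU
  have h0 : ∀ j, 0 ≤ ((star U * S * U) j j).re := fun j =>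
    (Complex.nonneg_iff.1 (hS.conjTranspose_mul_mul_same U).diag_nonneg).1
  have h1 : ∀ j, ((star U * S * U) j j).re ≤ 1 := by
    intro j
    have h := ((Matrix.le_iff.1 hS1).conjTranspose_mul_mul_same U).diag_nonneg (i := j)
    rw [mul_sub, sub_mul, mul_one, ← star_eq_conjTranspose, hU'] at h
    have := (Complex.nonneg_iff.1 h).1
    simp only [Matrix.sub_apply, one_apply_eq, Complex.sub_re, Complex.one_re] at this
    linarith
  have htr : S.trace.re = ∑ j, ((star U * S * U) j j).re := by
    have : (star U * S * U).trace = S.trace := by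
      rw [trace_mul_comm, ← mul_assoc, hU, one_mul]
    rw [← this, trace, Complex.re_sum]
    rfl
  rw [trace_conj_diagonal_mul, htr, Finset.mul_sum, ← Finset.sum_add_distrib]
  refine Finset.sum_le_sum fun j _ => ?_
  split_ifs with h
  · have := mul_le_mul_of_nonneg_left (h1 j) (hv j)
    have := mul_nonneg hκ (h0 j)
    linarith
  · have := mul_le_mul_of_nonneg_right (not_lt.1 h) (h0 j)
    linarith

/-- The spectral projection of a diagonalized state onto its large eigenvalues. -/
theorem exists_large_eigenvalue_projection {U : Matrix d d ℂ} (hU : U * star U = 1) {v : d → ℝ}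
    (hv : ∀ j, 0 ≤ v j) (hv1 : ∑ j, v j = 1) {θ : ℝ} (hθ : 0 < θ) :
    ∃ Q : Matrix d d ℂ, Q.PosSemidef ∧ Q ≤ 1 ∧ Q.trace.re ≤ θ⁻¹ ∧
      (U * diagonal (fun i => (v i : ℂ)) * star U * Q).trace.re =
        1 - ∑ j, if v j < θ then v j else 0 := by
  have hU' : star U * U = 1 := mul_eq_one_comm.1 hU
  set w : d → ℝ := fun j => if v j < θ then 0 else 1 with hw
  have hw0 : ∀ j, 0 ≤ w j := fun j => by simp only [hw]; split_ifs <;> norm_num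
  have hw1 : ∀ j, w j ≤ 1 := fun j => by simp only [hw]; split_ifs <;> norm_num
  have hQd : star U * (U * diagonal (fun i => (w i : ℂ)) * star U) * U =
      diagonal (fun i => (w i : ℂ)) := by
    rw [← mul_assoc, ← mul_assoc, hU', one_mul, mul_assoc, hU', mul_one]
  refine ⟨U * diagonal (fun i => (w i : ℂ)) * star U, ?_, ?_, ?_, ?_⟩
  · refine PosSemidef.mul_mul_conjTranspose_same (PosSemidef.diagonal fun i => ?_) _
    exact Complex.zero_le_real.2 (hw0 i)
  · have h : (1 : Matrix d d ℂ) - U * diagonal (fun i => (w i : ℂ)) * star U =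
        U * diagonal (fun i => ((1 - w i : ℝ) : ℂ)) * star U := by
      have e : diagonal (fun i => ((1 - w i : ℝ) : ℂ)) = 1 - diagonal (fun i => (w i : ℂ)) := by
        rw [← diagonal_one, diagonal_sub]
        push_cast
        rfl
      rw [e, mul_sub, sub_mul, mul_one, hU]
    rw [Matrix.le_iff, h]
    refine PosSemidef.mul_mul_conjTranspose_same (PosSemidef.diagonal fun i => ?_) _
    exact Complex.zero_le_real.2 (sub_nonneg.2 (hw1 i))
  · rw [mul_assoc, trace_mul_comm, mul_assoc, hU', mul_one, trace_diagonal, Complex.re_sum]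
    calc ∑ j, ((w j : ℝ) : ℂ).re ≤ ∑ j, θ⁻¹ * v j := by
          refine Finset.sum_le_sum fun j _ => ?_
          simp only [hw, Complex.ofReal_re]
          split_ifs with h
          · exact mul_nonneg (by positivity) (hv j)
          · rw [inv_mul_eq_div, one_le_div hθ]
            exact not_lt.1 h
      _ = θ⁻¹ := by rw [← Finset.mul_sum, hv1, mul_one]
  · rw [trace_conj_diagonal_mul, hQd, ← hv1, ← Finset.sum_sub_distrib]
    refine Finset.sum_congr rfl fun j _ => ?_
    simp only [diagonal_apply_eq, Complex.ofReal_re, hw]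
    split_ifs <;> simp

theorem entropy_eq_sum {A : Matrix d d ℂ} (hA : A.IsHermitian) :
    entropy A = -∑ i, hA.eigenvalues i * Real.log (hA.eigenvalues i) := by
  unfold entropy
  rw [mul_cfc_self hA, cfc_eq_conj hA, trace_mul_comm, ← mul_assoc, Unitary.coe_star_mul_self, one_mul,
    trace_diagonal, Complex.re_sum]
  simp only [Complex.ofReal_re]

end Diagonalized

/-! ### Tensor products of matrices -/

section ProductMatrix

variable {m : ℕ} {b : Type*}

/-- The tensor product of a family of matrices. -/
def productMatrix {b c : Type*} (X : Fin m → Matrix b c ℂ) : Matrix (Fin m → b) (Fin m → c) ℂ :=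
  Matrix.of fun a a' => ∏ i, X i (a i) (a' i)

theorem productMatrix_mul [Fintype b] [DecidableEq b] (X Y : Fin m → Matrix b b ℂ) :
    productMatrix X * productMatrix Y = productMatrix fun i => X i * Y i := by
  ext a a'
  simp only [productMatrix, mul_apply, of_apply, Fintype.prod_sum, Finset.prod_mul_distrib]

theorem productMatrix_star (X : Fin m → Matrix b b ℂ) :
    star (productMatrix X) = productMatrix fun i => star (X i) := by
  ext a a'
  simp only [productMatrix, star_apply, of_apply, star_prod]

theorem productMatrix_diagonal [DecidableEq b] (v : Fin m → b → ℂ) :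
    productMatrix (fun i => diagonal (v i)) = diagonal fun a => ∏ i, v i (a i) := by
  ext a a'
  simp only [productMatrix, of_apply, diagonal_apply]
  by_cases h : a = a'
  · simp [h]
  · rw [if_neg h]
    obtain ⟨i, hi⟩ := Function.ne_iff.1 h
    exact Finset.prod_eq_zero (Finset.mem_univ i) (if_neg hi)

theorem productMatrix_one [DecidableEq b] :
    productMatrix (fun _ : Fin m => (1 : Matrix b b ℂ)) = 1 := by
  simp only [← diagonal_one, productMatrix_diagonal, Finset.prod_const_one]

variable [Fintype b]

theorem trace_productMatrix [DecidableEq b] (X : Fin m → Matrix b b ℂ) :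
    (productMatrix X).trace = ∏ i, (X i).trace := by
  simp only [trace, diag_apply, productMatrix, of_apply, Fintype.prod_sum]

theorem sum_productMatrix {b X : Type*} [Fintype X] (F : X → Matrix b b ℂ) :
    ∑ x : Fin m → X, productMatrix (fun i => F (x i)) = productMatrix fun _ => ∑ x, F x := by
  classical
  ext a a'
  simp only [productMatrix, Matrix.sum_apply, of_apply, Fintype.prod_sum]

theorem productMatrix_smul {b : Type*} (c : Fin m → ℂ) (X : Fin m → Matrix b b ℂ) :
    productMatrix (fun i => c i • X i) = (∏ i, c i) • productMatrix X := by
  ext a a'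
  simp only [productMatrix, of_apply, Matrix.smul_apply, smul_eq_mul, Finset.prod_mul_distrib]

/-- In this diagonalization the eigenvalues are indexed by words and are products over letters, so
their logarithms are sums of independent terms. An arbitrary unitary is allowed in the cut-off
lemmas for this reason. -/
theorem productMatrix_eq_conj [DecidableEq b] {X : Fin m → Matrix b b ℂ}
    (hX : ∀ i, (X i).IsHermitian) :
    productMatrix X =
      productMatrix (fun i => ((hX i).eigenvectorUnitary : Matrix b b ℂ)) *
        diagonal (fun a => ((∏ i, (hX i).eigenvalues (a i) : ℝ) : ℂ)) *
          star (productMatrix fun i => ((hX i).eigenvectorUnitary : Matrix b b ℂ)) := by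
  have h : (fun a : Fin m → b => ((∏ i, (hX i).eigenvalues (a i) : ℝ) : ℂ)) =
      fun a => ∏ i, (((hX i).eigenvalues (a i) : ℝ) : ℂ) := by
    ext a
    push_cast
    rfl
  rw [h, ← productMatrix_diagonal fun i j => (((hX i).eigenvalues j : ℝ) : ℂ), productMatrix_mul,
    productMatrix_star, productMatrix_mul]
  congr 1
  ext1 i
  have := cfc_eq_conj (hX i) fun x => x
  rwa [cfc_real_id (hX i)] at this

theorem productMatrix_eigenvectorUnitary_mul_star [DecidableEq b] {X : Fin m → Matrix b b ℂ}
    (hX : ∀ i, (X i).IsHermitian) :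
    productMatrix (fun i => ((hX i).eigenvectorUnitary : Matrix b b ℂ)) *
      star (productMatrix fun i => ((hX i).eigenvectorUnitary : Matrix b b ℂ)) = 1 := by
  rw [productMatrix_star, productMatrix_mul]
  convert productMatrix_one (m := m) (b := b) using 2
  ext1 i
  exact Unitary.mul_star_self_of_mem (hX i).eigenvectorUnitary.2

theorem IsDensity.productMatrix {X : Fin m → Matrix b b ℂ}
    (hX : ∀ i, IsDensity (X i)) : IsDensity (productMatrix X) := by
  classical
  refine ⟨?_, ?_⟩
  · rw [productMatrix_eq_conj fun i => (hX i).1.1]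
    refine PosSemidef.mul_mul_conjTranspose_same (PosSemidef.diagonal fun a => ?_) _
    have : 0 ≤ ∏ i, (hX i).1.1.eigenvalues (a i) :=
      Finset.prod_nonneg fun i _ => (hX i).1.eigenvalues_nonneg _
    exact Complex.zero_le_real.2 this
  · rw [trace_productMatrix]
    simp [(hX _).2]

end ProductMatrix

/-! ### Coding for memoryless classical-quantum channels -/

section Memoryless

variable {X b : Type*} [Fintype X] [Fintype b]

theorem isDensity_sum {q : X → ℝ} {W : X → Matrix b b ℂ} (hq : ∀ x, 0 ≤ q x)
    (hq1 : ∑ x, q x = 1) (hW : ∀ x, IsDensity (W x)) : IsDensity (∑ x, (q x : ℂ) • W x) := by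
  refine ⟨posSemidef_sum _ fun x _ => (hW x).1.smul (Complex.zero_le_real.2 (hq x)), ?_⟩
  simp only [trace_sum, trace_smul, (hW _).2, smul_eq_mul, mul_one]
  exact_mod_cast hq1

theorem sum_trace_productMatrix_mul {m : ℕ} (q : X → ℝ) (W : X → Matrix b b ℂ)
    (S : Matrix (Fin m → b) (Fin m → b) ℂ) :
    ∑ x : Fin m → X, (∏ i, q (x i)) * (productMatrix (fun i => W (x i)) * S).trace.re =
      (productMatrix (fun _ => ∑ x, (q x : ℂ) • W x) * S).trace.re := by
  classical
  rw [← sum_productMatrix, Finset.sum_mul, trace_sum, Complex.re_sum]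
  refine Finset.sum_congr rfl fun x _ => ?_
  rw [productMatrix_smul, smul_mul_assoc, trace_smul, smul_eq_mul, ← Complex.re_ofReal_mul]
  push_cast
  rfl

theorem log_prod_of_prod_ne_zero {m : ℕ} {v : Fin m → ℝ} (h : ∏ i, v i ≠ 0) :
    Real.log (∏ i, v i) = ∑ i, Real.log (v i) :=
  Real.log_prod fun i _ hi => h (Finset.prod_eq_zero (Finset.mem_univ i) hi)

variable [DecidableEq b]

/-- Coding for a memoryless classical-quantum channel at rates below the Holevo information. -/
theorem eventually_exists_code {q : X → ℝ} {W : X → Matrix b b ℂ} (hq : ∀ x, 0 ≤ q x)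
    (hq1 : ∑ x, q x = 1) (hW : ∀ x, IsDensity (W x)) {R ε : ℝ} (hε : 0 < ε)
    (hR : R < entropy (∑ x, (q x : ℂ) • W x) - ∑ x, q x * entropy (W x)) :
    ∀ᶠ m : ℕ in atTop, ∃ M : ℕ, 0 < M ∧ m * R ≤ Real.log M ∧
      ∃ (x : Fin M → Fin m → X) (E : Fin M → Matrix (Fin m → b) (Fin m → b) ℂ),
        (∀ k, (E k).PosSemidef) ∧ ∑ k, E k = 1 ∧
          ∀ k, 1 - ε ≤ (productMatrix (fun i => W (x k i)) * E k).trace.re := by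
  -- For R < 0 one message is enough; R ≥ 0 is used below to bound the ceiling by 2 exp(mR).
  rcases lt_or_ge R 0 with hR0 | hR0
  · obtain ⟨x₀⟩ : Nonempty X := by
      by_contra h
      rw [not_nonempty_iff] at h
      simp at hq1
    refine Eventually.of_forall fun m => ⟨1, one_pos, ?_, fun _ _ => x₀, fun _ => 1,
      fun _ => PosSemidef.one, by simp, fun k => ?_⟩
    · simpa using mul_nonpos_of_nonneg_of_nonpos (Nat.cast_nonneg m) hR0.le
    · rw [mul_one, (IsDensity.productMatrix fun i => hW x₀).2, Complex.one_re]
      linarith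
  set σ := ∑ x, (q x : ℂ) • W x with hσdef
  have hσ : IsDensity σ := isDensity_sum hq hq1 hW
  set χ := entropy σ - ∑ x, q x * entropy (W x) with hχ
  -- The quarter of the gap gives c₁ + R + c₂ = -2δ, so the term κMR in `exists_code` decays
  -- exponentially.
  set δ := (χ - R) / 4 with hδ
  have hδ0 : 0 < δ := by rw [hδ]; linarith
  set mu := hσ.1.1.eigenvalues with hmu
  have hmu0 : ∀ j, 0 ≤ mu j := hσ.1.eigenvalues_nonneg
  set lam : X → b → ℝ := fun x => (hW x).1.1.eigenvalues with hlam
  have hlam0 : ∀ x j, 0 ≤ lam x j := fun x j => (hW x).1.eigenvalues_nonneg j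
  set c₁ := -entropy σ + δ with hc₁
  set c₂ := ∑ x, q x * entropy (W x) + δ with hc₂
  obtain ⟨r₁, hr₁0, hr₁1, hr₁⟩ := chernoff (p := mu) (f := fun j => Real.log (mu j)) (c := c₁)
    hmu0 hσ.sum_eigenvalues (by
      have := entropy_eq_sum hσ.1.1
      change ∑ j, mu j * Real.log (mu j) < c₁
      rw [hc₁, this]
      change _ < - -∑ j, mu j * Real.log (mu j) + δ
      linarith)
  -- The joint law of an input letter and an eigenvalue index of its output state; the mean of -log
  -- λ is the average output entropy.
  obtain ⟨r₂, hr₂0, hr₂1, hr₂⟩ := chernoff (p := fun z : X × b => q z.1 * lam z.1 z.2)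
    (f := fun z => -Real.log (lam z.1 z.2)) (c := c₂)
    (fun z => mul_nonneg (hq _) (hlam0 _ _))
    (by
      rw [Fintype.sum_prod_type]
      simp only [← Finset.mul_sum, hlam, (hW _).sum_eigenvalues, mul_one, hq1])
    (by
      rw [Fintype.sum_prod_type]
      have : ∀ x, ∑ j, q x * lam x j * -Real.log (lam x j) = q x * entropy (W x) := by
        intro x
        rw [entropy_eq_sum (hW x).1.1, ← Finset.sum_neg_distrib, Finset.mul_sum]
        exact Finset.sum_congr rfl fun j _ => by simp only [hlam]; ring
      simp only [this]
      linarith)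
  have hlim : Tendsto (fun m : ℕ => (1 + 1 / ε) * (2 * Real.exp (-(2 * δ)) ^ m + (r₁ ^ m + r₂ ^ m))
      + (r₁ ^ m + r₂ ^ m)) atTop (𝓝 0) := by
    have t1 := tendsto_pow_atTop_nhds_zero_of_lt_one hr₁0 hr₁1
    have t2 := tendsto_pow_atTop_nhds_zero_of_lt_one hr₂0 hr₂1
    have t3 := tendsto_pow_atTop_nhds_zero_of_lt_one (Real.exp_pos (-(2 * δ))).le
      (Real.exp_lt_one_iff.2 (by linarith))
    simpa using (((t3.const_mul 2).add (t1.add t2)).const_mul (1 + 1 / ε)).add (t1.add t2)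
  filter_upwards [hlim.eventually (gt_mem_nhds (by positivity : (0 : ℝ) < ε ^ 2))] with m hm
  have hM0 : 0 < ⌈Real.exp (m * R)⌉₊ := Nat.ceil_pos.2 (Real.exp_pos _)
  refine ⟨⌈Real.exp (m * R)⌉₊, hM0, ?_, ?_⟩
  · rw [Real.le_log_iff_exp_le (by exact_mod_cast hM0)]
    exact Nat.le_ceil _
  have hproj : ∀ x : Fin m → X, ∃ Q : Matrix (Fin m → b) (Fin m → b) ℂ, Q.PosSemidef ∧ Q ≤ 1 ∧
      Q.trace.re ≤ (Real.exp (-(m * c₂)))⁻¹ ∧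
      (productMatrix (fun i => W (x i)) * Q).trace.re = 1 - ∑ j : Fin m → b,
        if ∏ i, lam (x i) (j i) < Real.exp (-(m * c₂)) then ∏ i, lam (x i) (j i) else 0 := by
    intro x
    have hH := fun i => (hW (x i)).1.1
    rw [productMatrix_eq_conj hH]
    refine exists_large_eigenvalue_projection (productMatrix_eigenvectorUnitary_mul_star hH)
      (fun j => Finset.prod_nonneg fun i _ => hlam0 _ _) ?_ (Real.exp_pos _)
    rw [← Fintype.prod_sum (fun i j => lam (x i) j)]
    simp only [hlam, (hW _).sum_eigenvalues, Finset.prod_const_one]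
  choose Q hQ hQ1 hQtr hQW using hproj
  have hsmall₁ : ∑ j : Fin m → b,
      (if Real.exp (m * c₁) < ∏ i, mu (j i) then ∏ i, mu (j i) else 0) ≤ r₁ ^ m := by
    refine le_trans (Finset.sum_le_sum fun j _ => ?_) (hr₁ m)
    have hp : 0 ≤ ∏ i, mu (j i) := Finset.prod_nonneg fun i _ => hmu0 _
    split_ifs with h1 h2 h2
    · exact le_rfl
    · exfalso
      have hpos : 0 < ∏ i, mu (j i) := (Real.exp_pos _).trans h1
      rw [← log_prod_of_prod_ne_zero hpos.ne'] at h2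
      exact h2 ((Real.lt_log_iff_exp_lt hpos).2 h1).le
    · exact hp
    · exact le_rfl
  have hsmall₂ : ∑ x : Fin m → X, (∏ i, q (x i)) * ∑ j : Fin m → b,
      (if ∏ i, lam (x i) (j i) < Real.exp (-(m * c₂)) then ∏ i, lam (x i) (j i) else 0) ≤
        r₂ ^ m := by
    refine le_trans ?_ (hr₂ m)
    rw [← (Equiv.arrowProdEquivProdArrow (Fin m) (fun _ => X) (fun _ => b)).symm.sum_comp,
      Fintype.sum_prod_type]
    refine Finset.sum_le_sum fun x _ => ?_
    rw [Finset.mul_sum]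
    refine Finset.sum_le_sum fun j _ => ?_
    change _ ≤ if m * c₂ ≤ ∑ i, -Real.log (lam (x i) (j i)) then
      ∏ i, q (x i) * lam (x i) (j i) else 0
    have hp : 0 ≤ ∏ i, lam (x i) (j i) := Finset.prod_nonneg fun i _ => hlam0 _ _
    have hqp : 0 ≤ ∏ i, q (x i) := Finset.prod_nonneg fun i _ => hq _
    rw [Finset.prod_mul_distrib, Finset.sum_neg_distrib]
    split_ifs with h1 h2 h2
    · exact le_rfl
    -- A vanishing eigenvalue lies below the threshold but may miss the Chernoff event, because
    -- `Real.log 0 = 0`; its mass is zero anyway.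
    · rcases hp.eq_or_lt with h0 | hpos
      · rw [← h0, mul_zero]
      · exfalso
        rw [← log_prod_of_prod_ne_zero hpos.ne'] at h2
        have := (Real.log_lt_iff_lt_exp hpos).2 h1
        exact h2 (by linarith)
    · rw [mul_zero]
      exact mul_nonneg hqp hp
    · rw [mul_zero]
  have hq1' : ∑ x : Fin m → X, ∏ i, q (x i) = 1 := by
    rw [← Fintype.sum_pow, hq1, one_pow]
  have hr₁m : 0 ≤ r₁ ^ m := by positivity
  have hr₂m : 0 ≤ r₂ ^ m := by positivity
  refine exists_code (q := fun x : Fin m → X => ∏ i, q (x i))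
    (W := fun x => productMatrix fun i => W (x i)) (Q := Q) (R := (Real.exp (-(m * c₂)))⁻¹)
    (δ := r₁ ^ m + r₂ ^ m) (κ := Real.exp (m * c₁)) (ε := ε)
    (fun x => Finset.prod_nonneg fun i _ => hq _) hq1'
    (fun x => IsDensity.productMatrix fun i => hW _) hQ hQ1 hQtr ?_ (Real.exp_pos _).le
    (inv_nonneg.2 (Real.exp_pos _).le) ?_ hε hM0 ?_
  · simp only [hQW, mul_sub, mul_one, Finset.sum_sub_distrib, hq1']
    linarith
  · intro S hS hS1
    rw [sum_trace_productMatrix_mul]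
    have := trace_le_of_conj_diagonal (v := fun j : Fin m → b => ∏ i, mu (j i))
      (productMatrix_eigenvectorUnitary_mul_star fun _ : Fin m => hσ.1.1)
      (fun j : Fin m → b => Finset.prod_nonneg fun i _ => hmu0 (j i)) hS hS1
      (Real.exp_pos (m * c₁)).le
    rw [← hσdef, productMatrix_eq_conj fun _ => hσ.1.1]
    linarith
  · have hceil : (⌈Real.exp (m * R)⌉₊ : ℝ) ≤ 2 * Real.exp (m * R) := by
      have h1 := (Nat.ceil_lt_add_one (Real.exp_pos (m * R)).le).le
      have h2 : 1 ≤ Real.exp (m * R) := Real.one_le_exp (by positivity)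
      linarith
    have hexp : Real.exp (m * c₁) * (2 * Real.exp (m * R) * (Real.exp (-(m * c₂)))⁻¹) =
        2 * Real.exp (-(2 * δ)) ^ m := by
      rw [← Real.exp_neg, neg_neg, ← Real.exp_nat_mul, mul_assoc, mul_left_comm, ← Real.exp_add,
        ← Real.exp_add]
      congr 2
      have : c₁ + R + c₂ = -(2 * δ) := by
        rw [hc₁, hc₂, hδ, hχ]
        ring
      rw [← this]
      ring
    have hb : Real.exp (m * c₁) * (⌈Real.exp (m * R)⌉₊ * (Real.exp (-(m * c₂)))⁻¹) ≤
        2 * Real.exp (-(2 * δ)) ^ m := by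
      rw [← hexp]
      gcongr
    have hb2 := mul_le_mul_of_nonneg_left hb (by positivity : 0 ≤ 1 + 1 / ε)
    linarith

end Memoryless

/-! ### Tensor powers of channels -/

section TensorPower

variable {A B : Type*} [Fintype A] [DecidableEq A]

theorem map_apply_eq_sum (N : Matrix A A ℂ →ₗ[ℂ] Matrix B B ℂ) (X : Matrix A A ℂ) (u v : B) :
    N X u v = ∑ a, ∑ a', X a a' * N (single a a' 1) u v := by
  conv_lhs => rw [matrix_eq_sum_single X]
  simp only [map_sum, Matrix.sum_apply]
  refine Finset.sum_congr rfl fun a _ => Finset.sum_congr rfl fun a' _ => ?_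
  have h : single a a' (X a a') = X a a' • single a a' (1 : ℂ) := by
    simp [smul_single]
  rw [h, map_smul, Matrix.smul_apply, smul_eq_mul]

theorem tensorPower_apply (N : Matrix A A ℂ →ₗ[ℂ] Matrix B B ℂ) (n : ℕ)
    (X : Matrix (Fin n → A) (Fin n → A) ℂ) (b b' : Fin n → B) :
    tensorPower N n X b b' =
      ∑ a, ∑ a', X a a' * ∏ i, N (single (a i) (a' i) 1) (b i) (b' i) := rfl

theorem tensorPower_productMatrix (N : Matrix A A ℂ →ₗ[ℂ] Matrix B B ℂ) (n : ℕ)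
    (X : Fin n → Matrix A A ℂ) :
    tensorPower N n (productMatrix X) = productMatrix fun i => N (X i) :=
  tensorPower_prod N n X

theorem tensorPower_single (N : Matrix A A ℂ →ₗ[ℂ] Matrix B B ℂ) (n : ℕ) (a a' : Fin n → A)
    (b b' : Fin n → B) :
    tensorPower N n (single a a' 1) b b' = ∏ i, N (single (a i) (a' i) 1) (b i) (b' i) := by
  rw [tensorPower_apply, Finset.sum_eq_single a, Finset.sum_eq_single a']
  · simp
  · intro c _ hc
    rw [single_apply_of_col_ne _ _ hc.symm, zero_mul]
  · simp
  · intro c _ hc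
    refine Finset.sum_eq_zero fun c' _ => ?_
    rw [single_apply_of_row_ne hc.symm, zero_mul]
  · simp

/-- Grouping the factors of a tensor power into blocks. -/
def blockEquiv (C : Type*) (m k : ℕ) : (Fin (m * k) → C) ≃ (Fin m → Fin k → C) :=
  (Equiv.arrowCongr finProdFinEquiv.symm (Equiv.refl C)).trans (Equiv.curry _ _ _)

theorem tensorPower_mul (N : Matrix A A ℂ →ₗ[ℂ] Matrix B B ℂ) (m k : ℕ)
    (X : Matrix (Fin m → Fin k → A) (Fin m → Fin k → A) ℂ) :
    tensorPower N (m * k) (X.submatrix (blockEquiv A m k) (blockEquiv A m k)) =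
      (tensorPower (tensorPower N k) m X).submatrix (blockEquiv B m k) (blockEquiv B m k) := by
  ext b b'
  rw [submatrix_apply, tensorPower_apply, tensorPower_apply, ← (blockEquiv A m k).sum_comp]
  refine Finset.sum_congr rfl fun a _ => ?_
  rw [← (blockEquiv A m k).sum_comp]
  refine Finset.sum_congr rfl fun a' _ => ?_
  rw [submatrix_apply, ← finProdFinEquiv.prod_comp, Fintype.prod_prod_type]
  congr 1
  refine Finset.prod_congr rfl fun i _ => ?_
  rw [tensorPower_single]
  rfl

/-- Splitting off the first factor of a tensor power. -/
def headTailEquiv (C : Type*) (n : ℕ) : (Fin (n + 1) → C) ≃ C × (Fin n → C) :=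
  (Fin.consEquiv fun _ => C).symm

theorem tensorPower_succ (N : Matrix A A ℂ →ₗ[ℂ] Matrix B B ℂ) (n : ℕ) (Y : Matrix A A ℂ)
    (X : Matrix (Fin n → A) (Fin n → A) ℂ) :
    tensorPower N (n + 1) ((Y ⊗ₖ X).submatrix (headTailEquiv A n) (headTailEquiv A n)) =
      (N Y ⊗ₖ tensorPower N n X).submatrix (headTailEquiv B n) (headTailEquiv B n) := by
  ext b b'
  rw [submatrix_apply, kroneckerMap_apply, map_apply_eq_sum N Y, tensorPower_apply,
    tensorPower_apply, ← (headTailEquiv A n).symm.sum_comp, Fintype.sum_prod_type,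
    Finset.sum_mul]
  refine Finset.sum_congr rfl fun a _ => ?_
  rw [Finset.mul_sum]
  refine Finset.sum_congr rfl fun c _ => ?_
  rw [Finset.sum_mul_sum, ← (headTailEquiv A n).symm.sum_comp, Fintype.sum_prod_type]
  refine Finset.sum_congr rfl fun a' _ => Finset.sum_congr rfl fun c' _ => ?_
  rw [submatrix_apply, Equiv.apply_symm_apply, Equiv.apply_symm_apply, kroneckerMap_apply,
    Fin.prod_univ_succ]
  simp only [headTailEquiv, Equiv.symm_symm, Fin.consEquiv_apply, Fin.cons_zero, Fin.cons_succ]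
  change _ = Y a a' * N (single a a' 1) (b 0) (b' 0) *
    (X c c' * ∏ i, N (single (c i) (c' i) 1) (b i.succ) (b' i.succ))
  ring

variable [Fintype B]

/-- The Choi matrix of a completely positive map is positive semidefinite. -/
theorem IsQuantumChannel.choi_posSemidef {N : Matrix A A ℂ →ₗ[ℂ] Matrix B B ℂ}
    (hN : IsQuantumChannel N) :
    (Matrix.of fun x y : B × A => N (single x.2 y.2 1) x.1 y.1).PosSemidef := by
  set e := Fintype.equivFin A
  -- The unnormalized maximally entangled vector: the ampliated map sends its projector to the Choi
  -- matrix.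
  set v : A × Fin (Fintype.card A) → ℂ := fun z => if e z.1 = z.2 then 1 else 0 with hv
  have h := (hN.completelyPositive _ _ (posSemidef_vecMulVec_self_star v)).submatrix
    (fun x : B × A => (x.1, e x.2))
  convert h using 1
  ext x y
  have hs : single x.2 y.2 (1 : ℂ) =
      Matrix.of fun a a' => vecMulVec v (star v) (a, e x.2) (a', e y.2) := by
    ext a a'
    simp only [single_apply, of_apply, vecMulVec_apply, hv, Pi.star_apply,
      EmbeddingLike.apply_eq_iff_eq]
    by_cases h1 : a = x.2 <;> by_cases h2 : a' = y.2 <;> simp [h1, h2, eq_comm]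
  simp only [of_apply, submatrix_apply, ampliation]
  rw [hs]

/-- Factoring the Choi matrix as G*G gives Kraus operators for N. Their n-fold tensor products V κ
are Kraus operators for the tensor power, which makes positivity visible. -/
theorem IsQuantumChannel.tensorPower_posSemidef {N : Matrix A A ℂ →ₗ[ℂ] Matrix B B ℂ}
    (hN : IsQuantumChannel N) (n : ℕ) {X : Matrix (Fin n → A) (Fin n → A) ℂ}
    (hX : X.PosSemidef) : (tensorPower N n X).PosSemidef := by
  classical
  obtain ⟨G, hG⟩ := CStarAlgebra.nonneg_iff_eq_star_mul_self.1
    (Matrix.nonneg_iff_posSemidef.2 hN.choi_posSemidef)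
  have hentry : ∀ a a' b b', N (single a a' 1) b b' =
      ∑ k, star (G k (b, a)) * G k (b', a') := by
    intro a a' b b'
    have := congrFun (congrFun hG (b, a)) (b', a')
    simpa [mul_apply, star_apply] using this
  set V : (Fin n → B × A) → Matrix (Fin n → B) (Fin n → A) ℂ := fun κ =>
    Matrix.of fun b a => ∏ i, star (G (κ i) (b i, a i)) with hV
  have hkraus : tensorPower N n X = ∑ κ, V κ * X * (V κ)ᴴ := by
    ext b b'
    rw [tensorPower_apply, Matrix.sum_apply]
    simp only [hentry, Fintype.prod_sum, mul_apply, Finset.sum_mul, Finset.mul_sum,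
      conjTranspose_apply]
    rw [Finset.sum_comm]
    simp only [Finset.sum_comm (s := (Finset.univ : Finset (Fin n → A)))
      (t := (Finset.univ : Finset (Fin n → B × A)))]
    refine Finset.sum_congr rfl fun κ _ => Finset.sum_congr rfl fun a' _ =>
      Finset.sum_congr rfl fun a _ => ?_
    simp only [hV, of_apply, Finset.prod_mul_distrib, star_prod, star_star]
    ring
  rw [hkraus]
  exact posSemidef_sum _ fun κ _ => hX.mul_mul_conjTranspose_same _

theorem IsQuantumChannel.trace_tensorPower {N : Matrix A A ℂ →ₗ[ℂ] Matrix B B ℂ}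
    (hN : IsQuantumChannel N) (n : ℕ) (X : Matrix (Fin n → A) (Fin n → A) ℂ) :
    (tensorPower N n X).trace = X.trace := by
  classical
  simp only [trace, diag_apply, tensorPower_apply]
  rw [Finset.sum_comm]
  refine Finset.sum_congr rfl fun a _ => ?_
  rw [Finset.sum_comm]
  simp only [← Finset.mul_sum]
  have h : ∀ a' : Fin n → A, ∑ b : Fin n → B, ∏ i, N (single (a i) (a' i) 1) (b i) (b i) =
      if a = a' then 1 else 0 := by
    intro a'
    rw [← Fintype.prod_sum (fun i b => N (single (a i) (a' i) 1) b b)]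
    have : ∀ i, ∑ b, N (single (a i) (a' i) 1) b b = if a i = a' i then 1 else 0 := by
      intro i
      have := hN.tracePreserving (single (a i) (a' i) 1)
      simp only [trace, diag_apply] at this
      rw [this]
      by_cases h : a i = a' i
      · rw [if_pos h, h]
        simp [single_apply]
      · rw [if_neg h]
        refine Finset.sum_eq_zero fun j _ => ?_
        rw [single_apply, if_neg]
        rintro ⟨rfl, h'⟩
        exact h h'.symm
    simp only [this]
    by_cases h : a = a'
    · simp [h]
    · rw [if_neg h]
      obtain ⟨i, hi⟩ := Function.ne_iff.1 h
      exact Finset.prod_eq_zero (Finset.mem_univ i) (if_neg hi)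
  simp [h]

theorem IsQuantumChannel.isDensity_tensorPower {N : Matrix A A ℂ →ₗ[ℂ] Matrix B B ℂ}
    (hN : IsQuantumChannel N) (n : ℕ) {X : Matrix (Fin n → A) (Fin n → A) ℂ}
    (hX : IsDensity X) : IsDensity (tensorPower N n X) :=
  ⟨hN.tensorPower_posSemidef n hX.1, (hN.trace_tensorPower n X).trans hX.2⟩

end TensorPower

/-! ### Transport of codes between block lengths -/

section Codes

/-- Existence of a code with deterministic encoder and maximal error at most `ε`. -/
def HasCode {a b : Type*} [Fintype a] [Fintype b] [DecidableEq b]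
    (Φ : Matrix a a ℂ → Matrix b b ℂ) (M : ℕ) (ε : ℝ) : Prop :=
  ∃ (ρ : Fin M → Matrix a a ℂ) (E : Fin M → Matrix b b ℂ), (∀ m, IsDensity (ρ m)) ∧
    (∀ m, (E m).PosSemidef) ∧ ∑ m, E m = 1 ∧ ∀ m, 1 - ε ≤ (Φ (ρ m) * E m).trace.re

theorem le_average {M : ℕ} (hM : 0 < M) {x : ℝ} {f : Fin M → ℝ} (h : ∀ m, x ≤ f m) :
    x ≤ (1 / (M : ℝ)) * ∑ m, f m := by
  have hM' : (0 : ℝ) < M := by exact_mod_cast hM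
  have h1 := Finset.sum_le_sum fun m (_ : m ∈ Finset.univ) => h m
  rw [Finset.sum_const, Finset.card_univ, Fintype.card_fin, nsmul_eq_mul] at h1
  have h2 := mul_le_mul_of_nonneg_left h1 (by positivity : (0 : ℝ) ≤ 1 / M)
  rwa [← mul_assoc, one_div_mul_cancel hM'.ne', one_mul] at h2

theorem trace_submatrix_of_equiv {a a' : Type*} [Fintype a] [Fintype a'] (e : a' ≃ a)
    (X : Matrix a a ℂ) : (X.submatrix e e).trace = X.trace :=
  e.sum_comp fun i => X i i

theorem IsDensity.submatrix_equiv {a a' : Type*} [Fintype a] [Fintype a'] {X : Matrix a a ℂ}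
    (hX : IsDensity X) (e : a' ≃ a) : IsDensity (X.submatrix e e) :=
  ⟨hX.1.submatrix _, (trace_submatrix_of_equiv e X).trans hX.2⟩

theorem HasCode.reindex {a b a' b' : Type*} [Fintype a] [Fintype b] [DecidableEq b] [Fintype a']
    [Fintype b'] [DecidableEq b'] {Φ : Matrix a a ℂ → Matrix b b ℂ}
    {Ψ : Matrix a' a' ℂ → Matrix b' b' ℂ} (e : a' ≃ a) (f : b' ≃ b)
    (h : ∀ X, Ψ (X.submatrix e e) = (Φ X).submatrix f f) {M : ℕ} {ε : ℝ} (hΦ : HasCode Φ M ε) :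
    HasCode Ψ M ε := by
  obtain ⟨ρ, E, hρ, hE, hsum, hε⟩ := hΦ
  refine ⟨fun m => (ρ m).submatrix e e, fun m => (E m).submatrix f f,
    fun m => (hρ m).submatrix_equiv e, fun m => (hE m).submatrix _, ?_, fun m => ?_⟩
  · have : ∑ m, (E m).submatrix f f = (∑ m, E m).submatrix f f := by
      ext i j
      simp [Matrix.sum_apply]
    rw [this, hsum, submatrix_one_equiv]
  · rw [h, submatrix_mul_equiv, trace_submatrix_of_equiv]
    exact hε m

variable {A B : Type*} [Fintype A] [DecidableEq A] [Fintype B] [DecidableEq B]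

/-- The additional channel use carries a fixed state Y and the decoder ignores it. -/
theorem HasCode.succ {N : Matrix A A ℂ →ₗ[ℂ] Matrix B B ℂ} (hN : IsQuantumChannel N)
    {Y : Matrix A A ℂ} (hY : IsDensity Y) {n M : ℕ} {ε : ℝ} (h : HasCode (tensorPower N n) M ε) :
    HasCode (tensorPower N (n + 1)) M ε := by
  obtain ⟨ρ, E, hρ, hE, hsum, hε⟩ := h
  refine ⟨fun m => (Y ⊗ₖ ρ m).submatrix (headTailEquiv A n) (headTailEquiv A n),
    fun m => ((1 : Matrix B B ℂ) ⊗ₖ E m).submatrix (headTailEquiv B n) (headTailEquiv B n),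
    fun m => IsDensity.submatrix_equiv ⟨hY.1.kronecker (hρ m).1, ?_⟩ _,
    fun m => (PosSemidef.one.kronecker (hE m)).submatrix _, ?_, fun m => ?_⟩
  · rw [trace_kronecker, hY.2, (hρ m).2, one_mul]
  · have : ∑ m, ((1 : Matrix B B ℂ) ⊗ₖ E m).submatrix (headTailEquiv B n) (headTailEquiv B n) =
        ((1 : Matrix B B ℂ) ⊗ₖ ∑ m, E m).submatrix (headTailEquiv B n) (headTailEquiv B n) := by
      ext i j
      simp [Matrix.sum_apply, Finset.mul_sum]
    rw [this, hsum, one_kronecker_one, submatrix_one_equiv]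
  · rw [tensorPower_succ, submatrix_mul_equiv, trace_submatrix_of_equiv, ← mul_kronecker_mul,
      trace_kronecker, mul_one, hN.tracePreserving, hY.2, one_mul]
    exact hε m

theorem HasCode.mono {N : Matrix A A ℂ →ₗ[ℂ] Matrix B B ℂ} (hN : IsQuantumChannel N)
    {Y : Matrix A A ℂ} (hY : IsDensity Y) {n n' M : ℕ} (hn : n ≤ n') {ε : ℝ}
    (h : HasCode (tensorPower N n) M ε) : HasCode (tensorPower N n') M ε :=
  Nat.le_induction h (fun _ _ ih => ih.succ hN hY) n' hn

theorem HasCode.exists_code {a b : Type*} [Fintype a] [Fintype b] [DecidableEq b]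
    {Φ : Matrix a a ℂ →ₗ[ℂ] Matrix b b ℂ} {M : ℕ} {ε : ℝ} (h : HasCode Φ M ε) (hM : 0 < M)
    (crit : ErrorCriterion) : ∃ c : Code a b M, c.HasError Φ ε crit := by
  obtain ⟨ρ, E, hρ, hE, hsum, hε⟩ := h
  let c : Code a b M :=
    { labels := M
      p := fun m l => if l = m then 1 else 0
      ρ := ρ
      E := E
      p_nonneg := fun m l => by split_ifs <;> norm_num
      p_sum := fun m => by simp
      isDensity := hρ
      E_posSemidef := hE
      E_sum := hsum }
  have hs : ∀ m, 1 - ε ≤ c.successProb Φ m := by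
    intro m
    have : c.codeword m = ρ m := by
      simp [c, Code.codeword]
    rw [Code.successProb, this]
    exact hε m
  refine ⟨c, ?_⟩
  cases crit with
  | maximal => exact hs
  | average => exact le_average hM hs

end Codes

/-! ### Achievability of block Holevo informations -/

section Capacity

variable {A B : Type*} [Fintype A] [DecidableEq A] [Fintype B] [DecidableEq B]

theorem Ensemble.nonempty {d : Type*} [Fintype d] (e : Ensemble d) : Nonempty d := by
  by_contra h
  rw [not_nonempty_iff] at h
  have : IsEmpty (Fin e.card) := ⟨fun x => h.false (e.isDensity x).nonempty.some⟩
  simpa using e.p_sum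

theorem exists_isDensity (A : Type*) [Fintype A] [DecidableEq A] [Nonempty A] :
    ∃ Y : Matrix A A ℂ, IsDensity Y := by
  obtain ⟨a⟩ := ‹Nonempty A›
  refine ⟨diagonal (Pi.single a 1), PosSemidef.diagonal ?_, ?_⟩
  · exact Pi.single_nonneg.2 zero_le_one
  · rw [trace_diagonal]
    simp

/-- The direct part of the coding theorem: normalized Holevo informations are achievable. -/
theorem mem_achievableRates {N : Matrix A A ℂ →ₗ[ℂ] Matrix B B ℂ} (hN : IsQuantumChannel N)
    (crit : ErrorCriterion) {k : ℕ} (hk : 0 < k) (e : Ensemble (Fin k → A)) {ε R : ℝ}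
    (hε : 0 < ε) (hR : R * k < e.holevoInfo (tensorPower N k)) :
    R ∈ achievableRates N crit ε := by
  have hA : Nonempty A := by
    obtain ⟨f⟩ := e.nonempty
    exact ⟨f ⟨0, hk⟩⟩
  obtain ⟨Y, hY⟩ := exists_isDensity A
  obtain ⟨R₁, hR₁, hR₂⟩ := exists_between hR
  have hcode := eventually_exists_code e.p_nonneg e.p_sum
    (fun x => hN.isDensity_tensorPower k (e.isDensity x)) hε hR₂
  -- When k does not divide n, fewer than k uses are wasted. The surplus R₁ - Rk per block
  -- eventually pays for them.
  have hlarge : ∀ᶠ m : ℕ in atTop, (k : ℝ) * |R| ≤ m * (R₁ - R * k) :=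
    (tendsto_natCast_atTop_atTop.atTop_mul_const (sub_pos.2 hR₁)).eventually_ge_atTop _
  obtain ⟨m₀, hm₀⟩ := eventually_atTop.1 (hcode.and hlarge)
  intro δ hδ
  refine ⟨(m₀ + 1) * k, fun n hn => ?_⟩
  have hm : m₀ + 1 ≤ n / k := (Nat.le_div_iff_mul_le hk).2 hn
  obtain ⟨⟨M, hM, hlog, x, E, hE, hsum, hsucc⟩, hbig⟩ := hm₀ (n / k) (by omega)
  have h1 : HasCode (tensorPower (tensorPower N k) (n / k)) M ε := by
    refine ⟨fun l => productMatrix fun i => e.ρ (x l i), E,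
      fun l => IsDensity.productMatrix fun i => e.isDensity _, hE, hsum, fun l => ?_⟩
    rw [tensorPower_productMatrix]
    exact hsucc l
  have h2 : HasCode (tensorPower N (n / k * k)) M ε :=
    h1.reindex (blockEquiv A _ k) (blockEquiv B _ k) (tensorPower_mul N (n / k) k)
  obtain ⟨c, hc⟩ := (h2.mono hN hY (Nat.div_mul_le_self n k)).exists_code hM crit
  refine ⟨M, c, hc, ?_⟩
  have hn0 : (0 : ℝ) < n := by
    have : 0 < n := lt_of_lt_of_le (by positivity) hn
    exact_mod_cast this
  have hdiv : (n : ℝ) = (n / k : ℕ) * k + (n % k : ℕ) := by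
    have := Nat.div_add_mod' n k
    exact_mod_cast this.symm
  have hmod : ((n % k : ℕ) : ℝ) * R ≤ k * |R| := by
    have h3 : ((n % k : ℕ) : ℝ) ≤ k := by exact_mod_cast (Nat.mod_lt n hk).le
    calc ((n % k : ℕ) : ℝ) * R ≤ ((n % k : ℕ) : ℝ) * |R| := by gcongr; exact le_abs_self R
      _ ≤ k * |R| := by gcongr
  have hmain : n * R ≤ Real.log M := by
    rw [hdiv, add_mul]
    linarith
  rw [one_div, ← div_eq_inv_mul, le_div_iff₀ hn0]
  have := mul_pos hδ hn0
  linarith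

/-- Every smaller rate is achievable at each ε > 0, so the bound survives the limit ε → 0⁺. For an
optimal ensemble it reads χ(N^k)/k ≤ C. -/
theorem holevoInfo_div_le_capacity {N : Matrix A A ℂ →ₗ[ℂ] Matrix B B ℂ}
    (hN : IsQuantumChannel N) (crit : ErrorCriterion) {k : ℕ} (hk : 0 < k)
    (e : Ensemble (Fin k → A)) :
    ((e.holevoInfo (tensorPower N k) / k : ℝ) : EReal) ≤ capacity N crit := by
  refine ge_of_tendsto (tendsto_capacity N crit) ?_
  filter_upwards [self_mem_nhdsWithin] with ε hε
  have hk' : (0 : ℝ) < k := by exact_mod_cast hk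
  refine le_of_forall_lt fun z hz => ?_
  obtain ⟨R, hR₁, hR₂⟩ := EReal.lt_iff_exists_real_btwn.1 hz
  refine hR₁.trans_le (le_sSup ⟨R, mem_achievableRates hN crit hk e hε ?_, rfl⟩)
  exact (lt_div_iff₀ hk').1 (EReal.coe_lt_coe_iff.1 hR₂)

end Capacity

/-! ### Output states against the optimal output state -/

section Output

variable {a b : Type*} [Fintype a] [Fintype b] [DecidableEq b]
  {Φ : Matrix a a ℂ →ₗ[ℂ] Matrix b b ℂ}

theorem le_holevoChi {ι : Type*} [Fintype ι] {p : ι → ℝ} {ρ : ι → Matrix a a ℂ}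
    (hp : ∀ x, 0 ≤ p x) (hp1 : ∑ x, p x = 1) (hρ : ∀ x, IsDensity (ρ x)) :
    ((entropy (∑ x, (p x : ℂ) • Φ (ρ x)) - ∑ x, p x * entropy (Φ (ρ x)) : ℝ) : EReal) ≤
      holevoChi Φ := by
  set f := (Fintype.equivFin ι).symm
  let e : Ensemble a :=
    { card := Fintype.card ι
      p := fun x => p (f x)
      ρ := fun x => ρ (f x)
      p_nonneg := fun x => hp _
      p_sum := (f.sum_comp p).trans hp1
      isDensity := fun x => hρ _ }
  have : e.holevoInfo Φ = entropy (∑ x, (p x : ℂ) • Φ (ρ x)) - ∑ x, p x * entropy (Φ (ρ x)) := by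
    rw [Ensemble.holevoInfo, Ensemble.output]
    exact congrArg₂ (fun X y => entropy X - y) (f.sum_comp fun x => (p x : ℂ) • Φ (ρ x))
      (f.sum_comp fun x => p x * entropy (Φ (ρ x)))
  rw [← this]
  exact le_iSup (fun e : Ensemble a => ((e.holevoInfo Φ : ℝ) : EReal)) e

theorem Ensemble.isDensity_output {b : Type*} [Fintype b]
    {Φ : Matrix a a ℂ →ₗ[ℂ] Matrix b b ℂ} (hΦ : ∀ X, IsDensity X → IsDensity (Φ X)) (e : Ensemble a) :
    IsDensity (e.output Φ) :=
  isDensity_sum e.p_nonneg e.p_sum fun x => hΦ _ (e.isDensity x)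

/-- The relative entropy of an ensemble output to the optimal output is at most the gap of the
Holevo informations. -/
theorem relEntropy_output_le (hΦ : ∀ X, IsDensity X → IsDensity (Φ X)) {e : Ensemble a}
    (he : holevoChi Φ = ((e.holevoInfo Φ : ℝ) : EReal)) {ι : Type*} [Fintype ι] {p : ι → ℝ}
    {ρ : ι → Matrix a a ℂ} (hp : ∀ x, 0 ≤ p x) (hp1 : ∑ x, p x = 1)
    (hρ : ∀ x, IsDensity (ρ x)) :
    ∃ r : ℝ, relEntropy (∑ x, (p x : ℂ) • Φ (ρ x)) (e.output Φ) = (r : EReal) ∧ 0 ≤ r ∧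
      r ≤ e.holevoInfo Φ -
        (entropy (∑ x, (p x : ℂ) • Φ (ρ x)) - ∑ x, p x * entropy (Φ (ρ x))) := by
  obtain ⟨r, hr, hr0, hr1⟩ := relEntropy_of_entropy_mix_le (e.isDensity_output hΦ)
    (isDensity_sum hp hp1 fun x => hΦ _ (hρ x))
    (K := e.holevoInfo Φ + ∑ x, p x * entropy (Φ (ρ x))) (by
      intro t ht0 ht1
      -- The mixed ensemble on the disjoint union: its Holevo information is at most that of e,
      -- which is the first-order bound on the entropy of the mixed output.
      have h := le_holevoChi (Φ := Φ) (ι := Fin e.card ⊕ ι)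
        (p := Sum.elim (fun x => (1 - t) * e.p x) (fun x => t * p x)) (ρ := Sum.elim e.ρ ρ)
        (by
          rintro (x | x)
          · exact mul_nonneg (sub_nonneg.2 ht1) (e.p_nonneg x)
          · exact mul_nonneg ht0.le (hp x))
        (by simp [Fintype.sum_sum_type, ← Finset.mul_sum, hp1, e.p_sum])
        (by
          rintro (x | x)
          · exact e.isDensity x
          · exact hρ x)
      rw [he, EReal.coe_le_coe_iff, Fintype.sum_sum_type, Fintype.sum_sum_type] at h
      simp only [Sum.elim_inl, Sum.elim_inr, mul_assoc, ← Finset.mul_sum, Complex.ofReal_mul,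
        mul_smul, ← Finset.smul_sum] at h
      change entropy (((1 - t : ℝ) : ℂ) • e.output Φ + _) - _ ≤ _ at h
      have h2 : e.holevoInfo Φ = entropy (e.output Φ) - ∑ x, e.p x * entropy (Φ (e.ρ x)) := rfl
      rw [h2] at h ⊢
      linarith)
  exact ⟨r, hr, hr0, by linarith⟩

theorem Code.isDensity_codeword {M : ℕ} (c : Code a b M) (m : Fin M) :
    IsDensity (c.codeword m) :=
  isDensity_sum (c.p_nonneg m) (c.p_sum m) c.isDensity

theorem Code.output_eq {M : ℕ} (c : Code a b M) :
    c.output Φ = (1 / (M : ℂ)) • ∑ m, Φ (c.codeword m) := by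
  simp only [Code.output, Code.codeword, map_sum, map_smul]

theorem Code.HasError.average {M : ℕ} (hM : 0 < M) {c : Code a b M} {ε : ℝ}
    {crit : ErrorCriterion} (h : c.HasError Φ ε crit) :
    1 - ε ≤ (1 / (M : ℝ)) * ∑ m, c.successProb Φ m := by
  cases crit with
  | average => exact h
  | maximal => exact le_average hM h

theorem Code.card_pos {M : ℕ} [Nonempty b] (c : Code a b M) : 0 < M := by
  rcases Nat.eq_zero_or_pos M with rfl | h
  · have := c.E_sum
    simp at this
  · exact h

/-- The comparison ensemble is uniform over the codewords f(m), with the encoder's randomness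
averaged inside each, because the decoder identifies only m. -/
theorem Code.relEntropy_output_le (hΦ : ∀ X, IsDensity X → IsDensity (Φ X)) {e : Ensemble a}
    (he : holevoChi Φ = ((e.holevoInfo Φ : ℝ) : EReal)) {M : ℕ} (hM : 0 < M) {c : Code a b M}
    {ε : ℝ} {crit : ErrorCriterion} (h : c.HasError Φ ε crit) :
    ∃ r : ℝ, relEntropy (c.output Φ) (e.output Φ) = (r : EReal) ∧ 0 ≤ r ∧
      r ≤ e.holevoInfo Φ - ((1 - 2 * ε) * Real.log M - 7) := by
  have hM' : (0 : ℝ) < M := by exact_mod_cast hM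
  have hconv := converse_bound hM (fun m => hΦ _ (c.isDensity_codeword m)) c.E_posSemidef c.E_sum
    (h.average hM)
  obtain ⟨r, hr, hr0, hr1⟩ := QuantumCode.relEntropy_output_le hΦ he
    (p := fun _ : Fin M => 1 / (M : ℝ)) (ρ := c.codeword) (fun _ => by positivity)
    (by simp [hM'.ne']) c.isDensity_codeword
  have hout : ∑ m, ((1 / (M : ℝ) : ℝ) : ℂ) • Φ (c.codeword m) = c.output Φ := by
    rw [c.output_eq, Finset.smul_sum]
    push_cast
    rfl
  rw [hout] at hr hr1
  rw [← c.output_eq] at hconv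
  rw [← Finset.mul_sum] at hr1
  exact ⟨r, hr, hr0, by linarith⟩

theorem Ensemble.holevoInfo_le_log_card (hΦ : ∀ X, IsDensity X → IsDensity (Φ X))
    (e : Ensemble a) : e.holevoInfo Φ ≤ Real.log (Fintype.card b) := by
  have h1 := entropy_le_log_card (e.isDensity_output hΦ)
  have h2 : 0 ≤ ∑ x, e.p x * entropy (Φ (e.ρ x)) := Finset.sum_nonneg fun x _ =>
    mul_nonneg (e.p_nonneg x) (entropy_nonneg (hΦ _ (e.isDensity x)))
  rw [Ensemble.holevoInfo]
  linarith

end Output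

end QuantumCode

/-! ### The limit theorem -/

open QuantumCode in
theorem theorem1 {A B : Type*} [Fintype A] [DecidableEq A] [Fintype B] [DecidableEq B]
    (N : Matrix A A ℂ →ₗ[ℂ] Matrix B B ℂ) (hN : QuantumCode.IsQuantumChannel N)
    (crit : QuantumCode.ErrorCriterion) (M : ℕ → ℕ) (ε : ℕ → ℝ)
    (c : (n : ℕ) → QuantumCode.Code (Fin n → A) (Fin n → B) (M n))
    (hc : QuantumCode.IsGoodCodeSequence N crit M ε c)
    (e : (n : ℕ) → QuantumCode.Ensemble (Fin n → A))
    (he : ∀ n, QuantumCode.holevoChi (QuantumCode.tensorPower N n) =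
      (((e n).holevoInfo (QuantumCode.tensorPower N n) : ℝ) : EReal)) :
    Tendsto (fun n : ℕ => (((1 / (n : ℝ) : ℝ) : EReal)) *
        QuantumCode.relEntropy ((c n).output (QuantumCode.tensorPower N n))
          ((e n).output (QuantumCode.tensorPower N n)))
      atTop (𝓝 0) := by
  have hΦ : ∀ n X, IsDensity X → IsDensity (tensorPower N n X) :=
    fun n X hX => hN.isDensity_tensorPower n hX
  have hM : ∀ n, 0 < M n := fun n => by
    have := ((e n).isDensity_output (hΦ n)).nonempty
    exact (c n).card_pos
  have hbound := fun n => Code.relEntropy_output_le (hΦ n) (he n) (hM n) (hc.hasError n)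
  choose r hr hr0 hr1 using hbound
  set L : ℕ → ℝ := fun n => 1 / (n : ℝ) * Real.log (M n) with hL
  have hL0 : ∀ n, 0 ≤ L n := fun n =>
    mul_nonneg (by positivity) (Real.log_nonneg (by exact_mod_cast hM n))
  have hscaled : ∀ n : ℕ, 0 < n → 1 / (n : ℝ) * r n ≤
      (e n).holevoInfo (tensorPower N n) / n - (1 - 2 * ε n) * L n + 7 * (1 / (n : ℝ)) := by
    intro n _
    have := mul_le_mul_of_nonneg_left (hr1 n) (by positivity : (0 : ℝ) ≤ 1 / n)
    refine this.trans_eq ?_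
    rw [hL]
    ring
  have hε : Tendsto (fun n => 1 - 2 * ε n) atTop (𝓝 1) := by
    simpa using (hc.error.const_mul 2).const_sub 1
  have hinv : Tendsto (fun n : ℕ => 7 * (1 / (n : ℝ))) atTop (𝓝 0) := by
    simpa using tendsto_one_div_atTop_nhds_zero_nat.const_mul (7 : ℝ)
  have hbot : capacity N crit ≠ ⊥ := fun h => by
    have := holevoInfo_div_le_capacity hN crit one_pos (e 1)
    rw [h, le_bot_iff] at this
    exact EReal.coe_ne_bot _ this
  -- Nonnegativity of r acts as a converse: once 1 - 2ε ≥ 1/2, half the rate is at most log |B| + 7,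
  -- so the limit of the rates is finite.
  have htop : capacity N crit ≠ ⊤ := fun h => by
    have hle : capacity N crit ≤ ((2 * (Real.log (Fintype.card B) + 7) : ℝ) : EReal) := by
      refine le_of_tendsto hc.rate ?_
      filter_upwards [eventually_gt_atTop 0,
        hε.eventually (lt_mem_nhds (by norm_num : (1 / 2 : ℝ) < 1))] with n hn hhalf
      rw [EReal.coe_le_coe_iff]
      change L n ≤ _
      have hn' : (0 : ℝ) < n := by exact_mod_cast hn
      have hn1 : (1 : ℝ) ≤ n := by exact_mod_cast hn
      have h1 := (e n).holevoInfo_le_log_card (hΦ n)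
      rw [Fintype.card_fun, Fintype.card_fin, Nat.cast_pow, Real.log_pow] at h1
      have h2 : (e n).holevoInfo (tensorPower N n) / n ≤ Real.log (Fintype.card B) := by
        rw [div_le_iff₀ hn']
        linarith
      have h3 : 1 / (n : ℝ) ≤ 1 := by
        rw [div_le_one hn']
        exact hn1
      have h4 : 0 ≤ 1 / (n : ℝ) * r n := mul_nonneg (by positivity) (hr0 n)
      have h5 := mul_le_mul_of_nonneg_right hhalf.le (hL0 n)
      linarith [hscaled n hn]
    rw [h, top_le_iff] at hle
    exact EReal.coe_ne_top _ hle
  obtain ⟨C, hC⟩ : ∃ C : ℝ, capacity N crit = C :=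
    ⟨_, (EReal.coe_toReal htop hbot).symm⟩
  have hrate : Tendsto L atTop (𝓝 C) := by
    have := hc.rate
    rw [hC] at this
    exact EReal.tendsto_coe.1 this
  have hupper : Tendsto (fun n : ℕ => C - (1 - 2 * ε n) * L n + 7 * (1 / (n : ℝ))) atTop
      (𝓝 0) := by
    simpa using ((hε.mul hrate).const_sub C).add hinv
  -- The direct part bounds χ_n / n by C, the very number to which the rates converge, so the upper
  -- bound closes to 0.
  have hreal : Tendsto (fun n : ℕ => 1 / (n : ℝ) * r n) atTop (𝓝 0) := by
    refine squeeze_zero' (Eventually.of_forall fun n => mul_nonneg (by positivity) (hr0 n)) ?_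
      hupper
    filter_upwards [eventually_gt_atTop 0] with n hn
    have h1 := holevoInfo_div_le_capacity hN crit hn (e n)
    rw [hC, EReal.coe_le_coe_iff] at h1
    linarith [hscaled n hn]
  simp only [hr, ← EReal.coe_mul]
  exact EReal.tendsto_coe.2 hreal
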